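/- Let $G$ be a finite group and let $f : k \to R$ and $g : R \to S$ be morphisms of $G$-Tambara functors. A module over a Tambara functor is a module over its underlying Green functor. Definitions, for a morphism $k \to R$ of Tambara functors: * $R$ is *finitely presented* over $k$ if, as a $k$-algebra, it is isomorphic to a coequalizer $\mathrm{Coeq}(k[x_i]_{i\in I} \rightrightarrows k[x_j]_{j \in J})$ of free polynomial $k$-algebras on finitely many generators. Here each generator is placed in the level of some finite $G$-set, and the free polynomial $k$-algebra on generators in levels $X_1,\dots,X_n$ represents the functor $T \mapsto T(X_1)\times\cdots\times T(X_n)$ on $k$-algebras. * $R$ is *flat* over $k$ if the functor $R \boxtimes_k -$ on $k$-modules is exact. * Let $I$ be the kernel of the multiplication map $R \boxtimes_k R \to R$, and let $I^{>1} \subseteq I$ be the Tambara ideal generated by all products of two elements of $I(X)$ (for finite $G$-sets $X$) and all norms of elements of $I$ along maps $G/K \to G/H$ that are not isomorphisms. The *genuine Kähler differentials* are $\Omega^{1,\mathrm{Tamb}}_{R/k} := I/I^{>1}$. * $k \to R$ is *étale* if it is finitely presented, flat, and $\Omega^{1,\mathrm{Tamb}}_{R/k} = 0$. Then: 1. If $S$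 is finitely presented over $R$ and $R$ is finitely presented over $k$, then $S$ is finitely presented over $k$. 2. If $S$ is flat over $R$ and $R$ is flat over $k$, then $S$ is flat over $k$. 3. If $\Omega^{1,\mathrm{Tamb}}_{S/R} = 0$ and $\Omega^{1,\mathrm{Tamb}}_{R/k} = 0$, then $\Omega^{1,\mathrm{Tamb}}_{S/k} = 0$. Consequently, if $f$ and $g$ are étale, then $g \circ f : k \to S$ is étale. -/

import Mathlib

open CategoryTheory CategoryTheory.Limits

universe u v

/-! ## Finite `G`-sets -/

/-- A finite `G`-set, with underlying set `{0, …, card - 1}`. Every finite `G`-set is isomorphic to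
one of these (`FinGSet.exists_equiv`), and there is only a small set of them. -/
structure FinGSet (G : Type u) [Group G] : Type u where
  card : ℕ
  action : MulAction G (Fin card)

namespace FinGSet

variable {G : Type u} [Group G]

/-- The underlying set of a finite `G`-set. -/
def Carrier (X : FinGSet G) : Type := Fin X.card

instance : CoeSort (FinGSet G) Type := ⟨Carrier⟩

instance (X : FinGSet G) : MulAction G X := X.action

instance (X : FinGSet G) : Finite X := inferInstanceAs (Finite (Fin X.card))

theorem exists_equiv (A : Type v) [Finite A] [MulAction G A] :
    ∃ (X : FinGSet G) (e : A ≃ X), ∀ (g : G) (a : A), e (g • a) = g • e a := by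
  let e : A ≃ Fin (Nat.card A) := Finite.equivFin A
  let act : MulAction G (Fin (Nat.card A)) := e.symm.mulAction G
  refine ⟨⟨Nat.card A, act⟩, e, fun g a => ?_⟩
  change e (g • a) = e (g • e.symm (e a))
  rw [Equiv.symm_apply_apply]

/-- The square
```
W --a--> X
|b       |c
Y --d--> Z
```
of finite `G`-sets is a pullback. -/
structure IsPullback {W X Y Z : FinGSet G} (a : W →[G] X) (b : W →[G] Y)
    (c : X →[G] Z) (d : Y →[G] Z) : Prop where
  comm : ∀ w, c (a w) = d (b w)
  existsUnique : ∀ x y, c x = d y → ∃! w, a w = x ∧ b w = y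

/-- `Z` is the disjoint union of `X` and `Y` along the maps `i` and `j`. -/
def IsCoproduct {X Y Z : FinGSet G} (i : X →[G] Z) (j : Y →[G] Z) : Prop :=
  Function.Bijective (Sum.elim (fun x => i x) (fun y => j y))

/-- The diagram
```
X <--p-- A <--e-- B
|f                |f'
Y <-------q------ P
```
is an exponential diagram: `P = Π_f A` is the set of pairs of a point `y` of `Y` and a section `s`
of `p` over the fibre of `f` at `y`, `B = X ×_Y P`, and `e` is evaluation of sections. -/
structure IsExponential {A B P X Y : FinGSet G} (p : A →[G] X) (f : X →[G] Y)
    (e : B →[G] A) (f' : B →[G] P) (q : P →[G] Y) : Prop where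
  isPullback : IsPullback (p.comp e : B →[G] X) f' f q
  existsUnique : ∀ (y : Y) (s : {x : X // f x = y} → A), (∀ x, p (s x) = x) →
    ∃! z : P, q z = y ∧ ∀ b : B, f' b = z → ∀ x : {x : X // f x = y}, p (e b) = x → e b = s x

/-- The empty `G`-set. -/
def empty (G : Type u) [Group G] : FinGSet G where
  card := 0
  action := { smul := fun _ x => x, one_smul := fun _ => rfl, mul_smul := fun _ _ _ => rfl }

theorem empty_elim (x : empty G) : False := Fin.elim0 x

/-- The map from the empty `G`-set. -/
def fromEmpty (X : FinGSet G) : empty G →[G] X where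
  toFun x := (empty_elim x).elim
  map_smul' _ x := (empty_elim x).elim

theorem isCoproduct_empty :
    IsCoproduct (MulActionHom.id G : empty G →[G] empty G) (MulActionHom.id G) :=
  ⟨fun x => (Sum.elim empty_elim empty_elim x).elim, fun z => (empty_elim z).elim⟩

theorem IsCoproduct.isPullback_left {X Y Z : FinGSet G} {i : X →[G] Z} {j : Y →[G] Z}
    (h : IsCoproduct i j) :
    IsPullback (MulActionHom.id G : X →[G] X) (MulActionHom.id G) i i where
  comm _ := rfl
  existsUnique x y hxy := by
    have : Sum.inl x = (Sum.inl y : X ⊕ Y) := h.1 hxy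
    cases this
    exact ⟨x, ⟨rfl, rfl⟩, fun w hw => hw.1⟩

theorem IsCoproduct.symm {X Y Z : FinGSet G} {i : X →[G] Z} {j : Y →[G] Z}
    (h : IsCoproduct i j) : IsCoproduct j i := by
  have : (Sum.elim (fun y => j y) (fun x => i x)) =
      (Sum.elim (fun x => i x) (fun y => j y)) ∘ Sum.swap := by
    ext x; cases x <;> rfl
  rw [IsCoproduct, this]
  exact h.comp (Equiv.sumComm _ _).bijective

theorem IsCoproduct.isPullback_empty {X Y Z : FinGSet G} {i : X →[G] Z} {j : Y →[G] Z}
    (h : IsCoproduct i j) : IsPullback (fromEmpty X) (fromEmpty Y) i j where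
  comm w := (empty_elim w).elim
  existsUnique x y hxy := by
    have : Sum.inl x = (Sum.inr y : X ⊕ Y) := h.1 hxy
    cases this

end FinGSet

/-! ## Tambara functors -/

/-- A `G`-Tambara functor: commutative rings `T(X)` for finite `G`-sets `X`, with restrictions,
transfers and norms along all maps of finite `G`-sets. -/
structure TambaraFunctor (G : Type u) [Group G] : Type (u + 1) where
  obj : FinGSet G → Type u
  [ring : ∀ X, CommRing (obj X)]
  res : ∀ {X Y : FinGSet G}, (X →[G] Y) → (obj Y →+* obj X)
  tr : ∀ {X Y : FinGSet G}, (X →[G] Y) → (obj X →+ obj Y)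
  nm : ∀ {X Y : FinGSet G}, (X →[G] Y) → (obj X →* obj Y)
  res_id : ∀ {X : FinGSet G} (a : obj X), res (MulActionHom.id G) a = a
  tr_id : ∀ {X : FinGSet G} (a : obj X), tr (MulActionHom.id G) a = a
  nm_id : ∀ {X : FinGSet G} (a : obj X), nm (MulActionHom.id G) a = a
  res_comp : ∀ {X Y Z : FinGSet G} (g : Y →[G] Z) (f : X →[G] Y) (a : obj Z),
    res (g.comp f) a = res f (res g a)
  tr_comp : ∀ {X Y Z : FinGSet G} (g : Y →[G] Z) (f : X →[G] Y) (a : obj X),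
    tr (g.comp f) a = tr g (tr f a)
  nm_comp : ∀ {X Y Z : FinGSet G} (g : Y →[G] Z) (f : X →[G] Y) (a : obj X),
    nm (g.comp f) a = nm g (nm f a)
  /-- Disjoint unions are sent to products. The case `∅ = ∅ ⊔ ∅` says that `T(∅) = 0`. -/
  bijective : ∀ {X Y Z : FinGSet G} (i : X →[G] Z) (j : Y →[G] Z), FinGSet.IsCoproduct i j →
    Function.Bijective (fun a : obj Z => (res i a, res j a))
  res_tr : ∀ {W X Y Z : FinGSet G} (a : W →[G] X) (b : W →[G] Y) (c : X →[G] Z) (d : Y →[G] Z),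
    FinGSet.IsPullback a b c d → ∀ y : obj Y, res c (tr d y) = tr a (res b y)
  res_nm : ∀ {W X Y Z : FinGSet G} (a : W →[G] X) (b : W →[G] Y) (c : X →[G] Z) (d : Y →[G] Z),
    FinGSet.IsPullback a b c d → ∀ y : obj Y, res c (nm d y) = nm a (res b y)
  /-- Norms distribute over transfers. -/
  nm_tr : ∀ {A B P X Y : FinGSet G} (p : A →[G] X) (f : X →[G] Y) (e : B →[G] A)
    (f' : B →[G] P) (q : P →[G] Y), FinGSet.IsExponential p f e f' q →
    ∀ a : obj A, nm f (tr p a) = tr q (nm f' (res e a))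
  /-- Frobenius reciprocity. This is the case of a fold map `f : Y ⊔ Y → Y` in `nm_tr`,
  recorded for convenience. -/
  tr_res_mul : ∀ {X Y : FinGSet G} (f : X →[G] Y) (c : obj Y) (a : obj X),
    tr f (res f c * a) = c * tr f a

attribute [instance] TambaraFunctor.ring

namespace TambaraFunctor

variable {G : Type u} [Group G]

/-- Morphisms of Tambara functors. -/
@[ext]
structure Hom (S T : TambaraFunctor G) : Type u where
  app : ∀ X : FinGSet G, S.obj X →+* T.obj X
  app_res : ∀ {X Y : FinGSet G} (f : X →[G] Y) (a : S.obj Y),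
    app X (S.res f a) = T.res f (app Y a)
  app_tr : ∀ {X Y : FinGSet G} (f : X →[G] Y) (a : S.obj X),
    app Y (S.tr f a) = T.tr f (app X a)
  app_nm : ∀ {X Y : FinGSet G} (f : X →[G] Y) (a : S.obj X),
    app Y (S.nm f a) = T.nm f (app X a)

instance : Category (TambaraFunctor G) where
  Hom := Hom
  id T := ⟨fun _ => RingHom.id _, fun _ _ => rfl, fun _ _ => rfl, fun _ _ => rfl⟩
  comp φ ψ :=
    { app := fun X => (ψ.app X).comp (φ.app X)
      app_res := fun f a => by simp [φ.app_res, ψ.app_res]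
      app_tr := fun f a => by simp [φ.app_tr, ψ.app_tr]
      app_nm := fun f a => by simp [φ.app_nm, ψ.app_nm] }

end TambaraFunctor

/-! ## Modules over Tambara functors -/

/-- A module over (the underlying Green functor of) a Tambara functor `k`: a Mackey functor `M` with
`k(X)`-module structures on `M(X)` that satisfy Frobenius reciprocity. -/
structure TModule {G : Type u} [Group G] (k : TambaraFunctor G) : Type (u + 1) where
  obj : FinGSet G → Type u
  [addCommGroup : ∀ X, AddCommGroup (obj X)]
  [instModule : ∀ X, Module (k.obj X) (obj X)]
  res : ∀ {X Y : FinGSet G}, (X →[G] Y) → (obj Y →+ obj X)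
  tr : ∀ {X Y : FinGSet G}, (X →[G] Y) → (obj X →+ obj Y)
  res_id : ∀ {X : FinGSet G} (a : obj X), res (MulActionHom.id G) a = a
  tr_id : ∀ {X : FinGSet G} (a : obj X), tr (MulActionHom.id G) a = a
  res_comp : ∀ {X Y Z : FinGSet G} (g : Y →[G] Z) (f : X →[G] Y) (a : obj Z),
    res (g.comp f) a = res f (res g a)
  tr_comp : ∀ {X Y Z : FinGSet G} (g : Y →[G] Z) (f : X →[G] Y) (a : obj X),
    tr (g.comp f) a = tr g (tr f a)
  bijective : ∀ {X Y Z : FinGSet G} (i : X →[G] Z) (j : Y →[G] Z), FinGSet.IsCoproduct i j →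
    Function.Bijective (fun a : obj Z => (res i a, res j a))
  res_tr : ∀ {W X Y Z : FinGSet G} (a : W →[G] X) (b : W →[G] Y) (c : X →[G] Z) (d : Y →[G] Z),
    FinGSet.IsPullback a b c d → ∀ y : obj Y, res c (tr d y) = tr a (res b y)
  res_smul : ∀ {X Y : FinGSet G} (f : X →[G] Y) (c : k.obj Y) (m : obj Y),
    res f (c • m) = k.res f c • res f m
  tr_res_smul : ∀ {X Y : FinGSet G} (f : X →[G] Y) (c : k.obj Y) (m : obj X),
    tr f (k.res f c • m) = c • tr f m
  tr_smul_res : ∀ {X Y : FinGSet G} (f : X →[G] Y) (c : k.obj X) (m : obj Y),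
    tr f (c • res f m) = k.tr f c • m

attribute [instance] TModule.addCommGroup TModule.instModule

namespace TModule

variable {G : Type u} [Group G] {k : TambaraFunctor G}

/-- Morphisms of `k`-modules. -/
structure Hom (M N : TModule k) : Type u where
  app : ∀ X : FinGSet G, M.obj X →ₗ[k.obj X] N.obj X
  app_res : ∀ {X Y : FinGSet G} (f : X →[G] Y) (a : M.obj Y),
    app X (M.res f a) = N.res f (app Y a)
  app_tr : ∀ {X Y : FinGSet G} (f : X →[G] Y) (a : M.obj X),
    app Y (M.tr f a) = N.tr f (app X a)

/-- `M = 0`. -/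
def IsZero (M : TModule k) : Prop := ∀ X : FinGSet G, Subsingleton (M.obj X)

/-- The sequence `A → B → C` of `k`-modules is exact at `B`. -/
def Exact {A B C : TModule k} (φ : Hom A B) (ψ : Hom B C) : Prop :=
  ∀ X : FinGSet G, Function.Exact (φ.app X) (ψ.app X)

theorem eq_zero_of_empty (M : TModule k) (a : M.obj (FinGSet.empty G)) : a = 0 := by
  obtain ⟨b, hb⟩ := (M.bijective _ _ FinGSet.isCoproduct_empty).2 (a, 0)
  simp only [M.res_id, Prod.mk.injEq] at hb
  exact hb.1.symm.trans hb.2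

theorem eq_tr_add_tr (M : TModule k) {X Y Z : FinGSet G} {i : X →[G] Z} {j : Y →[G] Z}
    (h : FinGSet.IsCoproduct i j) (a : M.obj Z) :
    a = M.tr i (M.res i a) + M.tr j (M.res j a) := by
  apply (M.bijective i j h).1
  simp only [map_add]
  rw [M.res_tr _ _ _ _ h.isPullback_left, M.res_tr _ _ _ _ h.symm.isPullback_left,
    M.res_tr _ _ _ _ h.isPullback_empty, M.res_tr _ _ _ _ h.symm.isPullback_empty,
    M.eq_zero_of_empty (M.res _ (M.res j a)), M.eq_zero_of_empty (M.res _ (M.res i a))]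
  simp [M.res_id, M.tr_id]

end TModule

/-- A Tambara functor as a module over itself. -/
def TambaraFunctor.toModule {G : Type u} [Group G] (T : TambaraFunctor G) : TModule T where
  obj := T.obj
  res f := (T.res f).toAddMonoidHom
  tr f := T.tr f
  res_id := T.res_id
  tr_id := T.tr_id
  res_comp := T.res_comp
  tr_comp := T.tr_comp
  bijective := T.bijective
  res_tr := T.res_tr
  res_smul f c m := map_mul (T.res f) c m
  tr_res_smul := T.tr_res_mul
  tr_smul_res f c m := by
    change T.tr f (c * T.res f m) = T.tr f c * m
    rw [mul_comm, T.tr_res_mul, mul_comm]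

/-- Restriction of scalars along a morphism of Tambara functors. -/
def TModule.restrictScalars {G : Type u} [Group G] {k R : TambaraFunctor G} (φ : k ⟶ R)
    (M : TModule R) : TModule k where
  obj := M.obj
  instModule X := Module.compHom (M.obj X) (φ.app X)
  res := M.res
  tr := M.tr
  res_id := M.res_id
  tr_id := M.tr_id
  res_comp := M.res_comp
  tr_comp := M.tr_comp
  bijective := M.bijective
  res_tr := M.res_tr
  res_smul {X Y} f c m := by
    change M.res f (φ.app Y c • m) = φ.app X (k.res f c) • M.res f m
    rw [M.res_smul, φ.app_res]
  tr_res_smul {X Y} f c m := by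
    change M.tr f (φ.app X (k.res f c) • m) = φ.app Y c • M.tr f m
    rw [φ.app_res, M.tr_res_smul]
  tr_smul_res {X Y} f c m := by
    change M.tr f (φ.app X c • M.res f m) = φ.app Y (k.tr f c) • m
    rw [M.tr_smul_res, φ.app_tr]

/-! ## The relative box product of modules and flatness -/

namespace TModule

variable {G : Type u} [Group G] {k : TambaraFunctor G}

/-- A (Dress) pairing of `k`-modules `M`, `N` with values in a `k`-module `P`. -/
structure Pairing (M N P : TModule k) : Type u where
  app : ∀ X : FinGSet G, M.obj X →ₗ[k.obj X] N.obj X →ₗ[k.obj X] P.obj X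
  app_res : ∀ {X Y : FinGSet G} (f : X →[G] Y) (m : M.obj Y) (n : N.obj Y),
    app X (M.res f m) (N.res f n) = P.res f (app Y m n)
  app_tr_left : ∀ {X Y : FinGSet G} (f : X →[G] Y) (m : M.obj X) (n : N.obj Y),
    app Y (M.tr f m) n = P.tr f (app X m (N.res f n))
  app_tr_right : ∀ {X Y : FinGSet G} (f : X →[G] Y) (m : M.obj Y) (n : N.obj X),
    app Y m (N.tr f n) = P.tr f (app X (M.res f m) n)

/-- Formal expressions in symbols `m ⊗ n` and the operations of a `k`-module. -/
inductive BoxTerm (M N : TModule k) : FinGSet G → Type u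
  | tmul {X : FinGSet G} (m : M.obj X) (n : N.obj X) : BoxTerm M N X
  | zero {X : FinGSet G} : BoxTerm M N X
  | add {X : FinGSet G} (a b : BoxTerm M N X) : BoxTerm M N X
  | neg {X : FinGSet G} (a : BoxTerm M N X) : BoxTerm M N X
  | smul {X : FinGSet G} (c : k.obj X) (a : BoxTerm M N X) : BoxTerm M N X
  | resOp {X Y : FinGSet G} (f : X →[G] Y) (a : BoxTerm M N Y) : BoxTerm M N X
  | trOp {X Y : FinGSet G} (f : X →[G] Y) (a : BoxTerm M N X) : BoxTerm M N Y

open BoxTerm in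
/-- The congruence generated by the axioms of a `k`-module and the axioms which make
`(m, n) ↦ m ⊗ n` a pairing. -/
inductive BoxRel (M N : TModule k) : ∀ {X : FinGSet G}, BoxTerm M N X → BoxTerm M N X → Prop
  | refl {X : FinGSet G} (a : BoxTerm M N X) : BoxRel M N a a
  | symm {X : FinGSet G} {a b : BoxTerm M N X} : BoxRel M N a b → BoxRel M N b a
  | trans {X : FinGSet G} {a b c : BoxTerm M N X} :
      BoxRel M N a b → BoxRel M N b c → BoxRel M N a c
  | add_congr {X : FinGSet G} {a a' b b' : BoxTerm M N X} :
      BoxRel M N a a' → BoxRel M N b b' → BoxRel M N (add a b) (add a' b')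
  | neg_congr {X : FinGSet G} {a a' : BoxTerm M N X} :
      BoxRel M N a a' → BoxRel M N (neg a) (neg a')
  | smul_congr {X : FinGSet G} (c : k.obj X) {a a' : BoxTerm M N X} :
      BoxRel M N a a' → BoxRel M N (smul c a) (smul c a')
  | res_congr {X Y : FinGSet G} (f : X →[G] Y) {a a' : BoxTerm M N Y} :
      BoxRel M N a a' → BoxRel M N (resOp f a) (resOp f a')
  | tr_congr {X Y : FinGSet G} (f : X →[G] Y) {a a' : BoxTerm M N X} :
      BoxRel M N a a' → BoxRel M N (trOp f a) (trOp f a')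
  | add_assoc {X : FinGSet G} (a b c : BoxTerm M N X) :
      BoxRel M N (add (add a b) c) (add a (add b c))
  | zero_add {X : FinGSet G} (a : BoxTerm M N X) : BoxRel M N (add zero a) a
  | add_comm {X : FinGSet G} (a b : BoxTerm M N X) : BoxRel M N (add a b) (add b a)
  | neg_add {X : FinGSet G} (a : BoxTerm M N X) : BoxRel M N (add (neg a) a) zero
  | smul_add {X : FinGSet G} (c : k.obj X) (a b : BoxTerm M N X) :
      BoxRel M N (smul c (add a b)) (add (smul c a) (smul c b))
  | add_smul {X : FinGSet G} (c d : k.obj X) (a : BoxTerm M N X) :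
      BoxRel M N (smul (c + d) a) (add (smul c a) (smul d a))
  | mul_smul {X : FinGSet G} (c d : k.obj X) (a : BoxTerm M N X) :
      BoxRel M N (smul (c * d) a) (smul c (smul d a))
  | one_smul {X : FinGSet G} (a : BoxTerm M N X) : BoxRel M N (smul 1 a) a
  | res_add {X Y : FinGSet G} (f : X →[G] Y) (a b : BoxTerm M N Y) :
      BoxRel M N (resOp f (add a b)) (add (resOp f a) (resOp f b))
  | tr_add {X Y : FinGSet G} (f : X →[G] Y) (a b : BoxTerm M N X) :
      BoxRel M N (trOp f (add a b)) (add (trOp f a) (trOp f b))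
  | res_id {X : FinGSet G} (a : BoxTerm M N X) : BoxRel M N (resOp (MulActionHom.id G) a) a
  | tr_id {X : FinGSet G} (a : BoxTerm M N X) : BoxRel M N (trOp (MulActionHom.id G) a) a
  | res_comp {X Y Z : FinGSet G} (g : Y →[G] Z) (f : X →[G] Y) (a : BoxTerm M N Z) :
      BoxRel M N (resOp (g.comp f) a) (resOp f (resOp g a))
  | tr_comp {X Y Z : FinGSet G} (g : Y →[G] Z) (f : X →[G] Y) (a : BoxTerm M N X) :
      BoxRel M N (trOp (g.comp f) a) (trOp g (trOp f a))
  | coproduct {X Y Z : FinGSet G} (i : X →[G] Z) (j : Y →[G] Z) (h : FinGSet.IsCoproduct i j)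
      (a : BoxTerm M N Z) : BoxRel M N a (add (trOp i (resOp i a)) (trOp j (resOp j a)))
  | res_tr {W X Y Z : FinGSet G} (a : W →[G] X) (b : W →[G] Y) (c : X →[G] Z) (d : Y →[G] Z)
      (h : FinGSet.IsPullback a b c d) (y : BoxTerm M N Y) :
      BoxRel M N (resOp c (trOp d y)) (trOp a (resOp b y))
  | res_smul {X Y : FinGSet G} (f : X →[G] Y) (c : k.obj Y) (a : BoxTerm M N Y) :
      BoxRel M N (resOp f (smul c a)) (smul (k.res f c) (resOp f a))
  | tr_res_smul {X Y : FinGSet G} (f : X →[G] Y) (c : k.obj Y) (a : BoxTerm M N X) :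
      BoxRel M N (trOp f (smul (k.res f c) a)) (smul c (trOp f a))
  | tr_smul_res {X Y : FinGSet G} (f : X →[G] Y) (c : k.obj X) (a : BoxTerm M N Y) :
      BoxRel M N (trOp f (smul c (resOp f a))) (smul (k.tr f c) a)
  | add_tmul {X : FinGSet G} (m m' : M.obj X) (n : N.obj X) :
      BoxRel M N (tmul (m + m') n) (add (tmul m n) (tmul m' n))
  | tmul_add {X : FinGSet G} (m : M.obj X) (n n' : N.obj X) :
      BoxRel M N (tmul m (n + n')) (add (tmul m n) (tmul m n'))
  | smul_tmul {X : FinGSet G} (c : k.obj X) (m : M.obj X) (n : N.obj X) :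
      BoxRel M N (tmul (c • m) n) (smul c (tmul m n))
  | tmul_smul {X : FinGSet G} (c : k.obj X) (m : M.obj X) (n : N.obj X) :
      BoxRel M N (tmul m (c • n)) (smul c (tmul m n))
  | res_tmul {X Y : FinGSet G} (f : X →[G] Y) (m : M.obj Y) (n : N.obj Y) :
      BoxRel M N (tmul (M.res f m) (N.res f n)) (resOp f (tmul m n))
  | tr_tmul {X Y : FinGSet G} (f : X →[G] Y) (m : M.obj X) (n : N.obj Y) :
      BoxRel M N (tmul (M.tr f m) n) (trOp f (tmul m (N.res f n)))
  | tmul_tr {X Y : FinGSet G} (f : X →[G] Y) (m : M.obj Y) (n : N.obj X) :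
      BoxRel M N (tmul m (N.tr f n)) (trOp f (tmul (M.res f m) n))

/-- The equivalence relation `BoxRel` at level `X`. -/
def boxSetoid (M N : TModule k) (X : FinGSet G) : Setoid (BoxTerm M N X) where
  r := BoxRel M N
  iseqv := ⟨BoxRel.refl, BoxRel.symm, BoxRel.trans⟩

/-- The group `(M ⊠_k N)(X)`. -/
def BoxObj (M N : TModule k) (X : FinGSet G) : Type u := Quotient (boxSetoid M N X)

instance (M N : TModule k) (X : FinGSet G) : Add (BoxObj M N X) :=
  ⟨Quotient.map₂ BoxTerm.add fun _ _ h _ _ h' => BoxRel.add_congr h h'⟩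

instance (M N : TModule k) (X : FinGSet G) : Zero (BoxObj M N X) := ⟨Quotient.mk _ BoxTerm.zero⟩

instance (M N : TModule k) (X : FinGSet G) : Neg (BoxObj M N X) :=
  ⟨Quotient.map BoxTerm.neg fun _ _ h => BoxRel.neg_congr h⟩

instance (M N : TModule k) (X : FinGSet G) : AddCommGroup (BoxObj M N X) where
  nsmul := nsmulRec
  zsmul := zsmulRec
  add_assoc := by
    rintro ⟨a⟩ ⟨b⟩ ⟨c⟩; exact Quotient.sound (BoxRel.add_assoc a b c)
  zero_add := by
    rintro ⟨a⟩; exact Quotient.sound (BoxRel.zero_add a)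
  add_zero := by
    rintro ⟨a⟩; exact Quotient.sound ((BoxRel.add_comm _ _).trans (BoxRel.zero_add a))
  add_comm := by
    rintro ⟨a⟩ ⟨b⟩; exact Quotient.sound (BoxRel.add_comm a b)
  neg_add_cancel := by
    rintro ⟨a⟩; exact Quotient.sound (BoxRel.neg_add a)

instance (M N : TModule k) (X : FinGSet G) : SMul (k.obj X) (BoxObj M N X) where
  smul c := Quotient.map (BoxTerm.smul c) fun _ _ h => BoxRel.smul_congr c h

instance (M N : TModule k) (X : FinGSet G) : Module (k.obj X) (BoxObj M N X) :=
  Module.ofMinimalAxioms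
    (by rintro c ⟨a⟩ ⟨b⟩; exact Quotient.sound (BoxRel.smul_add c a b))
    (by rintro c d ⟨a⟩; exact Quotient.sound (BoxRel.add_smul c d a))
    (by rintro c d ⟨a⟩; exact Quotient.sound (BoxRel.mul_smul c d a))
    (by rintro ⟨a⟩; exact Quotient.sound (BoxRel.one_smul a))

/-- Restrictions in `M ⊠_k N`. -/
def boxRes (M N : TModule k) {X Y : FinGSet G} (f : X →[G] Y) : BoxObj M N Y →+ BoxObj M N X :=
  AddMonoidHom.mk' (Quotient.map (BoxTerm.resOp f) fun _ _ h => BoxRel.res_congr f h)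
    (by rintro ⟨a⟩ ⟨b⟩; exact Quotient.sound (BoxRel.res_add f a b))

/-- Transfers in `M ⊠_k N`. -/
def boxTr (M N : TModule k) {X Y : FinGSet G} (f : X →[G] Y) : BoxObj M N X →+ BoxObj M N Y :=
  AddMonoidHom.mk' (Quotient.map (BoxTerm.trOp f) fun _ _ h => BoxRel.tr_congr f h)
    (by rintro ⟨a⟩ ⟨b⟩; exact Quotient.sound (BoxRel.tr_add f a b))

/-- The relative box product `M ⊠_k N`, i.e. the `k`-module which receives the universal pairing
from `M` and `N`. -/
def box (M N : TModule k) : TModule k where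
  obj := BoxObj M N
  res := boxRes M N
  tr := boxTr M N
  res_id := by rintro X ⟨a⟩; exact Quotient.sound (BoxRel.res_id a)
  tr_id := by rintro X ⟨a⟩; exact Quotient.sound (BoxRel.tr_id a)
  res_comp := by rintro X Y Z g f ⟨a⟩; exact Quotient.sound (BoxRel.res_comp g f a)
  tr_comp := by rintro X Y Z g f ⟨a⟩; exact Quotient.sound (BoxRel.tr_comp g f a)
  res_tr := by rintro W X Y Z a b c d h ⟨y⟩; exact Quotient.sound (BoxRel.res_tr a b c d h y)
  res_smul := by rintro X Y f c ⟨a⟩; exact Quotient.sound (BoxRel.res_smul f c a)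
  tr_res_smul := by rintro X Y f c ⟨a⟩; exact Quotient.sound (BoxRel.tr_res_smul f c a)
  tr_smul_res := by rintro X Y f c ⟨a⟩; exact Quotient.sound (BoxRel.tr_smul_res f c a)
  bijective := by
    have decomp : ∀ {X Y Z : FinGSet G} (i : X →[G] Z) (j : Y →[G] Z),
        FinGSet.IsCoproduct i j → ∀ a : BoxObj M N Z,
        a = boxTr M N i (boxRes M N i a) + boxTr M N j (boxRes M N j a) := by
      rintro X Y Z i j h ⟨a⟩
      exact Quotient.sound (BoxRel.coproduct i j h a)
    have rid : ∀ {X : FinGSet G} (a : BoxObj M N X), boxRes M N (MulActionHom.id G) a = a := by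
      rintro X ⟨a⟩; exact Quotient.sound (BoxRel.res_id a)
    have tid : ∀ {X : FinGSet G} (a : BoxObj M N X), boxTr M N (MulActionHom.id G) a = a := by
      rintro X ⟨a⟩; exact Quotient.sound (BoxRel.tr_id a)
    have rtr : ∀ {W X Y Z : FinGSet G} (a : W →[G] X) (b : W →[G] Y) (c : X →[G] Z)
        (d : Y →[G] Z), FinGSet.IsPullback a b c d → ∀ y : BoxObj M N Y,
        boxRes M N c (boxTr M N d y) = boxTr M N a (boxRes M N b y) := by
      rintro W X Y Z a b c d h ⟨y⟩; exact Quotient.sound (BoxRel.res_tr a b c d h y)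
    have emp : ∀ a : BoxObj M N (FinGSet.empty G), a = 0 := by
      intro a
      have := decomp _ _ FinGSet.isCoproduct_empty a
      simpa [rid, tid] using this
    intro X Y Z i j h
    constructor
    · intro a b hab
      simp only [Prod.mk.injEq] at hab
      rw [decomp i j h a, decomp i j h b, hab.1, hab.2]
    · rintro ⟨a, b⟩
      refine ⟨boxTr M N i a + boxTr M N j b, ?_⟩
      simp only [map_add]
      rw [rtr _ _ _ _ h.isPullback_left, rtr _ _ _ _ h.symm.isPullback_left,
        rtr _ _ _ _ h.isPullback_empty, rtr _ _ _ _ h.symm.isPullback_empty,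
        emp (boxRes M N _ b), emp (boxRes M N _ a)]
      simp [rid, tid]

/-- The symbol `m ⊗ n` in `(M ⊠_k N)(X)`. -/
def BoxObj.tmul {M N : TModule k} {X : FinGSet G} (m : M.obj X) (n : N.obj X) : BoxObj M N X :=
  Quotient.mk _ (BoxTerm.tmul m n)

/-- The universal pairing `(m, n) ↦ m ⊗ n`. -/
def boxPairing (M N : TModule k) : Pairing M N (box M N) where
  app X := LinearMap.mk₂ (k.obj X) (fun m n => (BoxObj.tmul m n : (box M N).obj X))
    (fun m m' n => Quotient.sound (BoxRel.add_tmul m m' n))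
    (fun c m n => Quotient.sound (BoxRel.smul_tmul c m n))
    (fun m n n' => Quotient.sound (BoxRel.tmul_add m n n'))
    (fun c m n => Quotient.sound (BoxRel.tmul_smul c m n))
  app_res f m n := Quotient.sound (BoxRel.res_tmul f m n)
  app_tr_left f m n := Quotient.sound (BoxRel.tr_tmul f m n)
  app_tr_right f m n := Quotient.sound (BoxRel.tmul_tr f m n)

/-- The value of a formal expression under a pairing. -/
def BoxTerm.eval {M N P : TModule k} (θ : Pairing M N P) :
    ∀ {X : FinGSet G}, BoxTerm M N X → P.obj X
  | X, tmul m n => θ.app X m n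
  | _, zero => 0
  | _, add a b => eval θ a + eval θ b
  | _, neg a => - eval θ a
  | _, smul c a => c • eval θ a
  | _, resOp f a => P.res f (eval θ a)
  | _, trOp f a => P.tr f (eval θ a)

theorem BoxRel.eval_eq {M N P : TModule k} (θ : Pairing M N P) {X : FinGSet G}
    {a b : BoxTerm M N X} (h : BoxRel M N a b) : a.eval θ = b.eval θ := by
  induction h with
  | refl => rfl
  | symm _ ih => exact ih.symm
  | trans _ _ ih ih' => exact ih.trans ih'
  | add_congr _ _ ih ih' => simp only [BoxTerm.eval, ih, ih']
  | neg_congr _ ih => simp only [BoxTerm.eval, ih]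
  | smul_congr _ _ ih => simp only [BoxTerm.eval, ih]
  | res_congr _ _ ih => simp only [BoxTerm.eval, ih]
  | tr_congr _ _ ih => simp only [BoxTerm.eval, ih]
  | add_assoc => exact _root_.add_assoc _ _ _
  | zero_add => exact _root_.zero_add _
  | add_comm => exact _root_.add_comm _ _
  | neg_add => exact neg_add_cancel _
  | smul_add => exact _root_.smul_add _ _ _
  | add_smul => exact _root_.add_smul _ _ _
  | mul_smul => exact SemigroupAction.mul_smul _ _ _
  | one_smul => exact _root_.one_smul _ _
  | res_add => exact map_add _ _ _
  | tr_add => exact map_add _ _ _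
  | res_id => exact P.res_id _
  | tr_id => exact P.tr_id _
  | res_comp => exact P.res_comp _ _ _
  | tr_comp => exact P.tr_comp _ _ _
  | coproduct i j h => exact P.eq_tr_add_tr h _
  | res_tr a b c d h => exact P.res_tr _ _ _ _ h _
  | res_smul => exact P.res_smul _ _ _
  | tr_res_smul => exact P.tr_res_smul _ _ _
  | tr_smul_res => exact P.tr_smul_res _ _ _
  | add_tmul => simp only [BoxTerm.eval, map_add, LinearMap.add_apply]
  | tmul_add => simp only [BoxTerm.eval, map_add]
  | smul_tmul => simp only [BoxTerm.eval, map_smul, LinearMap.smul_apply]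
  | tmul_smul => simp only [BoxTerm.eval, map_smul]
  | res_tmul => exact θ.app_res _ _ _
  | tr_tmul => exact θ.app_tr_left _ _ _
  | tmul_tr => exact θ.app_tr_right _ _ _

/-- The morphism `M ⊠_k N → P` induced by a pairing. -/
def boxLift {M N P : TModule k} (θ : Pairing M N P) : Hom (box M N) P where
  app X :=
    { toFun := Quotient.lift (fun a => a.eval θ) fun _ _ h => BoxRel.eval_eq θ h
      map_add' := by rintro ⟨a⟩ ⟨b⟩; rfl
      map_smul' := by rintro c ⟨a⟩; rfl }
  app_res := by rintro X Y f ⟨a⟩; rfl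
  app_tr := by rintro X Y f ⟨a⟩; rfl

/-- The functor `M ⊠_k -` on morphisms; it sends `m ⊗ a` to `m ⊗ φ a`. -/
def boxMap (M : TModule k) {A B : TModule k} (φ : Hom A B) : Hom (box M A) (box M B) :=
  boxLift
    { app := fun X => ((boxPairing M B).app X).compl₂ (φ.app X)
      app_res := fun f m a => by
        simp only [LinearMap.compl₂_apply, φ.app_res, (boxPairing M B).app_res]
      app_tr_left := fun f m a => by
        simp only [LinearMap.compl₂_apply, φ.app_res, (boxPairing M B).app_tr_left]
      app_tr_right := fun f m a => by
        simp only [LinearMap.compl₂_apply, φ.app_tr, (boxPairing M B).app_tr_right] }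

/-- A `k`-module `M` is flat if the functor `M ⊠_k -` is exact. -/
def IsFlat (M : TModule k) : Prop :=
  ∀ (A B C : TModule k) (φ : Hom A B) (ψ : Hom B C),
    Exact φ ψ → Exact (boxMap M φ) (boxMap M ψ)

end TModule

/-! ## Tambara functors by generators and relations -/

namespace TambaraFunctor

variable {G : Type u} [Group G]

/-- Formal expressions in generators `Γ` and the operations of a Tambara functor. -/
inductive Term (Γ : FinGSet G → Type u) : FinGSet G → Type u
  | of {X : FinGSet G} (a : Γ X) : Term Γ X
  | zero {X : FinGSet G} : Term Γ X
  | one {X : FinGSet G} : Term Γ X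
  | add {X : FinGSet G} (a b : Term Γ X) : Term Γ X
  | mul {X : FinGSet G} (a b : Term Γ X) : Term Γ X
  | neg {X : FinGSet G} (a : Term Γ X) : Term Γ X
  | resOp {X Y : FinGSet G} (f : X →[G] Y) (a : Term Γ Y) : Term Γ X
  | trOp {X Y : FinGSet G} (f : X →[G] Y) (a : Term Γ X) : Term Γ Y
  | nmOp {X Y : FinGSet G} (f : X →[G] Y) (a : Term Γ X) : Term Γ Y

open Term in
/-- The congruence generated by the relations `E` and the axioms of a Tambara functor. -/
inductive Rel {Γ : FinGSet G → Type u} (E : ∀ X : FinGSet G, Term Γ X → Term Γ X → Prop) :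
    ∀ {X : FinGSet G}, Term Γ X → Term Γ X → Prop
  | of {X : FinGSet G} {a b : Term Γ X} : E X a b → Rel E a b
  | refl {X : FinGSet G} (a : Term Γ X) : Rel E a a
  | symm {X : FinGSet G} {a b : Term Γ X} : Rel E a b → Rel E b a
  | trans {X : FinGSet G} {a b c : Term Γ X} : Rel E a b → Rel E b c → Rel E a c
  | add_congr {X : FinGSet G} {a a' b b' : Term Γ X} :
      Rel E a a' → Rel E b b' → Rel E (add a b) (add a' b')
  | mul_congr {X : FinGSet G} {a a' b b' : Term Γ X} :
      Rel E a a' → Rel E b b' → Rel E (mul a b) (mul a' b')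
  | neg_congr {X : FinGSet G} {a a' : Term Γ X} : Rel E a a' → Rel E (neg a) (neg a')
  | res_congr {X Y : FinGSet G} (f : X →[G] Y) {a a' : Term Γ Y} :
      Rel E a a' → Rel E (resOp f a) (resOp f a')
  | tr_congr {X Y : FinGSet G} (f : X →[G] Y) {a a' : Term Γ X} :
      Rel E a a' → Rel E (trOp f a) (trOp f a')
  | nm_congr {X Y : FinGSet G} (f : X →[G] Y) {a a' : Term Γ X} :
      Rel E a a' → Rel E (nmOp f a) (nmOp f a')
  | add_assoc {X : FinGSet G} (a b c : Term Γ X) : Rel E (add (add a b) c) (add a (add b c))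
  | zero_add {X : FinGSet G} (a : Term Γ X) : Rel E (add zero a) a
  | add_comm {X : FinGSet G} (a b : Term Γ X) : Rel E (add a b) (add b a)
  | neg_add {X : FinGSet G} (a : Term Γ X) : Rel E (add (neg a) a) zero
  | mul_assoc {X : FinGSet G} (a b c : Term Γ X) : Rel E (mul (mul a b) c) (mul a (mul b c))
  | one_mul {X : FinGSet G} (a : Term Γ X) : Rel E (mul one a) a
  | mul_comm {X : FinGSet G} (a b : Term Γ X) : Rel E (mul a b) (mul b a)
  | mul_add {X : FinGSet G} (a b c : Term Γ X) :
      Rel E (mul a (add b c)) (add (mul a b) (mul a c))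
  | res_one {X Y : FinGSet G} (f : X →[G] Y) : Rel E (resOp f one) one
  | res_mul {X Y : FinGSet G} (f : X →[G] Y) (a b : Term Γ Y) :
      Rel E (resOp f (mul a b)) (mul (resOp f a) (resOp f b))
  | res_add {X Y : FinGSet G} (f : X →[G] Y) (a b : Term Γ Y) :
      Rel E (resOp f (add a b)) (add (resOp f a) (resOp f b))
  | tr_add {X Y : FinGSet G} (f : X →[G] Y) (a b : Term Γ X) :
      Rel E (trOp f (add a b)) (add (trOp f a) (trOp f b))
  | nm_one {X Y : FinGSet G} (f : X →[G] Y) : Rel E (nmOp f one) one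
  | nm_mul {X Y : FinGSet G} (f : X →[G] Y) (a b : Term Γ X) :
      Rel E (nmOp f (mul a b)) (mul (nmOp f a) (nmOp f b))
  | res_id {X : FinGSet G} (a : Term Γ X) : Rel E (resOp (MulActionHom.id G) a) a
  | tr_id {X : FinGSet G} (a : Term Γ X) : Rel E (trOp (MulActionHom.id G) a) a
  | nm_id {X : FinGSet G} (a : Term Γ X) : Rel E (nmOp (MulActionHom.id G) a) a
  | res_comp {X Y Z : FinGSet G} (g : Y →[G] Z) (f : X →[G] Y) (a : Term Γ Z) :
      Rel E (resOp (g.comp f) a) (resOp f (resOp g a))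
  | tr_comp {X Y Z : FinGSet G} (g : Y →[G] Z) (f : X →[G] Y) (a : Term Γ X) :
      Rel E (trOp (g.comp f) a) (trOp g (trOp f a))
  | nm_comp {X Y Z : FinGSet G} (g : Y →[G] Z) (f : X →[G] Y) (a : Term Γ X) :
      Rel E (nmOp (g.comp f) a) (nmOp g (nmOp f a))
  | coproduct {X Y Z : FinGSet G} (i : X →[G] Z) (j : Y →[G] Z) (h : FinGSet.IsCoproduct i j)
      (a : Term Γ Z) : Rel E a (add (trOp i (resOp i a)) (trOp j (resOp j a)))
  | res_tr {W X Y Z : FinGSet G} (a : W →[G] X) (b : W →[G] Y) (c : X →[G] Z) (d : Y →[G] Z)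
      (h : FinGSet.IsPullback a b c d) (y : Term Γ Y) :
      Rel E (resOp c (trOp d y)) (trOp a (resOp b y))
  | res_nm {W X Y Z : FinGSet G} (a : W →[G] X) (b : W →[G] Y) (c : X →[G] Z) (d : Y →[G] Z)
      (h : FinGSet.IsPullback a b c d) (y : Term Γ Y) :
      Rel E (resOp c (nmOp d y)) (nmOp a (resOp b y))
  | nm_tr {A B P X Y : FinGSet G} (p : A →[G] X) (f : X →[G] Y) (e : B →[G] A)
      (f' : B →[G] P) (q : P →[G] Y) (h : FinGSet.IsExponential p f e f' q) (a : Term Γ A) :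
      Rel E (nmOp f (trOp p a)) (trOp q (nmOp f' (resOp e a)))
  | tr_res_mul {X Y : FinGSet G} (f : X →[G] Y) (c : Term Γ Y) (a : Term Γ X) :
      Rel E (trOp f (mul (resOp f c) a)) (mul c (trOp f a))

section Presented

variable {Γ : FinGSet G → Type u} (E : ∀ X : FinGSet G, Term Γ X → Term Γ X → Prop)

/-- The equivalence relation `Rel E` at level `X`. -/
def relSetoid (X : FinGSet G) : Setoid (Term Γ X) where
  r := Rel E
  iseqv := ⟨Rel.refl, Rel.symm, Rel.trans⟩

/-- The values of the Tambara functor with generators `Γ` and relations `E`. -/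
def PresentedObj (X : FinGSet G) : Type u := Quotient (relSetoid E X)

instance (X : FinGSet G) : Add (PresentedObj E X) :=
  ⟨Quotient.map₂ Term.add fun _ _ h _ _ h' => Rel.add_congr h h'⟩

instance (X : FinGSet G) : Zero (PresentedObj E X) := ⟨Quotient.mk _ Term.zero⟩

instance (X : FinGSet G) : Neg (PresentedObj E X) :=
  ⟨Quotient.map Term.neg fun _ _ h => Rel.neg_congr h⟩

instance (X : FinGSet G) : Mul (PresentedObj E X) :=
  ⟨Quotient.map₂ Term.mul fun _ _ h _ _ h' => Rel.mul_congr h h'⟩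

instance (X : FinGSet G) : One (PresentedObj E X) := ⟨Quotient.mk _ Term.one⟩

instance (X : FinGSet G) : CommRing (PresentedObj E X) where
  nsmul := nsmulRec
  zsmul := zsmulRec
  add_assoc := by
    rintro ⟨a⟩ ⟨b⟩ ⟨c⟩; exact Quotient.sound (Rel.add_assoc a b c)
  zero_add := by
    rintro ⟨a⟩; exact Quotient.sound (Rel.zero_add a)
  add_zero := by
    rintro ⟨a⟩; exact Quotient.sound ((Rel.add_comm _ _).trans (Rel.zero_add a))
  add_comm := by
    rintro ⟨a⟩ ⟨b⟩; exact Quotient.sound (Rel.add_comm a b)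
  neg_add_cancel := by
    rintro ⟨a⟩; exact Quotient.sound (Rel.neg_add a)
  mul_assoc := by
    rintro ⟨a⟩ ⟨b⟩ ⟨c⟩; exact Quotient.sound (Rel.mul_assoc a b c)
  one_mul := by
    rintro ⟨a⟩; exact Quotient.sound (Rel.one_mul a)
  mul_one := by
    rintro ⟨a⟩; exact Quotient.sound ((Rel.mul_comm _ _).trans (Rel.one_mul a))
  mul_comm := by
    rintro ⟨a⟩ ⟨b⟩; exact Quotient.sound (Rel.mul_comm a b)
  left_distrib := by
    rintro ⟨a⟩ ⟨b⟩ ⟨c⟩; exact Quotient.sound (Rel.mul_add a b c)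
  right_distrib := by
    rintro ⟨a⟩ ⟨b⟩ ⟨c⟩
    exact Quotient.sound ((Rel.mul_comm _ _).trans ((Rel.mul_add c a b).trans
      (Rel.add_congr (Rel.mul_comm _ _) (Rel.mul_comm _ _))))
  zero_mul := by
    rintro ⟨a⟩
    have h1 : Rel E (Term.mul Term.zero a)
        (Term.add (Term.mul Term.zero a) (Term.mul Term.zero a)) :=
      (Rel.mul_comm _ _).trans (((Rel.mul_congr (Rel.refl a)
        (Rel.zero_add Term.zero).symm)).trans ((Rel.mul_add _ _ _).trans
        (Rel.add_congr (Rel.mul_comm _ _) (Rel.mul_comm _ _))))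
    exact Quotient.sound ((Rel.zero_add _).symm.trans ((Rel.add_congr
      (Rel.neg_add (Term.mul Term.zero a)).symm (Rel.refl _)).trans ((Rel.add_assoc _ _ _).trans
      ((Rel.add_congr (Rel.refl _) h1.symm).trans (Rel.neg_add _)))))
  mul_zero := by
    rintro ⟨a⟩
    have h1 : Rel E (Term.mul a Term.zero)
        (Term.add (Term.mul a Term.zero) (Term.mul a Term.zero)) :=
      (Rel.mul_congr (Rel.refl a) (Rel.zero_add Term.zero).symm).trans (Rel.mul_add _ _ _)
    exact Quotient.sound ((Rel.zero_add _).symm.trans ((Rel.add_congr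
      (Rel.neg_add (Term.mul a Term.zero)).symm (Rel.refl _)).trans ((Rel.add_assoc _ _ _).trans
      ((Rel.add_congr (Rel.refl _) h1.symm).trans (Rel.neg_add _)))))

/-- Restrictions in the Tambara functor with generators `Γ` and relations `E`. -/
def presentedRes {X Y : FinGSet G} (f : X →[G] Y) : PresentedObj E Y →+* PresentedObj E X :=
  RingHom.mk' ⟨⟨Quotient.map (Term.resOp f) fun _ _ h => Rel.res_congr f h,
      Quotient.sound (Rel.res_one f)⟩,
      by rintro ⟨a⟩ ⟨b⟩; exact Quotient.sound (Rel.res_mul f a b)⟩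
    (by rintro ⟨a⟩ ⟨b⟩; exact Quotient.sound (Rel.res_add f a b))

/-- Transfers in the Tambara functor with generators `Γ` and relations `E`. -/
def presentedTr {X Y : FinGSet G} (f : X →[G] Y) : PresentedObj E X →+ PresentedObj E Y :=
  AddMonoidHom.mk' (Quotient.map (Term.trOp f) fun _ _ h => Rel.tr_congr f h)
    (by rintro ⟨a⟩ ⟨b⟩; exact Quotient.sound (Rel.tr_add f a b))

/-- Norms in the Tambara functor with generators `Γ` and relations `E`. -/
def presentedNm {X Y : FinGSet G} (f : X →[G] Y) : PresentedObj E X →* PresentedObj E Y where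
  toFun := Quotient.map (Term.nmOp f) fun _ _ h => Rel.nm_congr f h
  map_one' := Quotient.sound (Rel.nm_one f)
  map_mul' := by rintro ⟨a⟩ ⟨b⟩; exact Quotient.sound (Rel.nm_mul f a b)

/-- The Tambara functor with generators `Γ` and relations `E`. -/
def presented : TambaraFunctor G where
  obj := PresentedObj E
  res := presentedRes E
  tr := presentedTr E
  nm := presentedNm E
  res_id := by rintro X ⟨a⟩; exact Quotient.sound (Rel.res_id a)
  tr_id := by rintro X ⟨a⟩; exact Quotient.sound (Rel.tr_id a)
  nm_id := by rintro X ⟨a⟩; exact Quotient.sound (Rel.nm_id a)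
  res_comp := by rintro X Y Z g f ⟨a⟩; exact Quotient.sound (Rel.res_comp g f a)
  tr_comp := by rintro X Y Z g f ⟨a⟩; exact Quotient.sound (Rel.tr_comp g f a)
  nm_comp := by rintro X Y Z g f ⟨a⟩; exact Quotient.sound (Rel.nm_comp g f a)
  res_tr := by rintro W X Y Z a b c d h ⟨y⟩; exact Quotient.sound (Rel.res_tr a b c d h y)
  res_nm := by rintro W X Y Z a b c d h ⟨y⟩; exact Quotient.sound (Rel.res_nm a b c d h y)
  nm_tr := by
    rintro A B P X Y p f e f' q h ⟨a⟩; exact Quotient.sound (Rel.nm_tr p f e f' q h a)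
  tr_res_mul := by rintro X Y f ⟨c⟩ ⟨a⟩; exact Quotient.sound (Rel.tr_res_mul f c a)
  bijective := by
    have decomp : ∀ {X Y Z : FinGSet G} (i : X →[G] Z) (j : Y →[G] Z),
        FinGSet.IsCoproduct i j → ∀ a : PresentedObj E Z,
        a = presentedTr E i (presentedRes E i a) + presentedTr E j (presentedRes E j a) := by
      rintro X Y Z i j h ⟨a⟩
      exact Quotient.sound (Rel.coproduct i j h a)
    have rid : ∀ {X : FinGSet G} (a : PresentedObj E X),
        presentedRes E (MulActionHom.id G) a = a := by
      rintro X ⟨a⟩; exact Quotient.sound (Rel.res_id a)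
    have tid : ∀ {X : FinGSet G} (a : PresentedObj E X),
        presentedTr E (MulActionHom.id G) a = a := by
      rintro X ⟨a⟩; exact Quotient.sound (Rel.tr_id a)
    have rtr : ∀ {W X Y Z : FinGSet G} (a : W →[G] X) (b : W →[G] Y) (c : X →[G] Z)
        (d : Y →[G] Z), FinGSet.IsPullback a b c d → ∀ y : PresentedObj E Y,
        presentedRes E c (presentedTr E d y) = presentedTr E a (presentedRes E b y) := by
      rintro W X Y Z a b c d h ⟨y⟩; exact Quotient.sound (Rel.res_tr a b c d h y)
    have emp : ∀ a : PresentedObj E (FinGSet.empty G), a = 0 := by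
      intro a
      have := decomp _ _ FinGSet.isCoproduct_empty a
      simpa [rid, tid] using this
    intro X Y Z i j h
    constructor
    · intro a b hab
      simp only [Prod.mk.injEq] at hab
      rw [decomp i j h a, decomp i j h b, hab.1, hab.2]
    · rintro ⟨a, b⟩
      refine ⟨presentedTr E i a + presentedTr E j b, ?_⟩
      simp only [map_add]
      rw [rtr _ _ _ _ h.isPullback_left, rtr _ _ _ _ h.symm.isPullback_left,
        rtr _ _ _ _ h.isPullback_empty, rtr _ _ _ _ h.symm.isPullback_empty,
        emp (presentedRes E _ b), emp (presentedRes E _ a)]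
      simp [rid, tid]

/-- The value of a formal expression for given values `φ` of the generators. -/
def Term.eval (T : TambaraFunctor G) (φ : ∀ X : FinGSet G, Γ X → T.obj X) :
    ∀ {X : FinGSet G}, Term Γ X → T.obj X
  | X, of a => φ X a
  | _, zero => 0
  | _, one => 1
  | _, add a b => eval T φ a + eval T φ b
  | _, mul a b => eval T φ a * eval T φ b
  | _, neg a => - eval T φ a
  | _, resOp f a => T.res f (eval T φ a)
  | _, trOp f a => T.tr f (eval T φ a)
  | _, nmOp f a => T.nm f (eval T φ a)

variable {E}

theorem Rel.eval_eq (T : TambaraFunctor G) (φ : ∀ X : FinGSet G, Γ X → T.obj X)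
    (hφ : ∀ (X : FinGSet G) (a b : Term Γ X), E X a b → a.eval T φ = b.eval T φ)
    {X : FinGSet G} {a b : Term Γ X} (h : Rel E a b) : a.eval T φ = b.eval T φ := by
  induction h with
  | of h => exact hφ _ _ _ h
  | refl => rfl
  | symm _ ih => exact ih.symm
  | trans _ _ ih ih' => exact ih.trans ih'
  | add_congr _ _ ih ih' => simp only [Term.eval, ih, ih']
  | mul_congr _ _ ih ih' => simp only [Term.eval, ih, ih']
  | neg_congr _ ih => simp only [Term.eval, ih]
  | res_congr _ _ ih => simp only [Term.eval, ih]
  | tr_congr _ _ ih => simp only [Term.eval, ih]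
  | nm_congr _ _ ih => simp only [Term.eval, ih]
  | add_assoc => exact _root_.add_assoc _ _ _
  | zero_add => exact _root_.zero_add _
  | add_comm => exact _root_.add_comm _ _
  | neg_add => exact neg_add_cancel _
  | mul_assoc => exact _root_.mul_assoc _ _ _
  | one_mul => exact _root_.one_mul _
  | mul_comm => exact _root_.mul_comm _ _
  | mul_add => exact _root_.mul_add _ _ _
  | res_one => exact map_one _
  | res_mul => exact map_mul _ _ _
  | res_add => exact map_add _ _ _
  | tr_add => exact map_add _ _ _
  | nm_one => exact map_one _
  | nm_mul => exact map_mul _ _ _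
  | res_id => exact T.res_id _
  | tr_id => exact T.tr_id _
  | nm_id => exact T.nm_id _
  | res_comp => exact T.res_comp _ _ _
  | tr_comp => exact T.tr_comp _ _ _
  | nm_comp => exact T.nm_comp _ _ _
  | coproduct i j h => exact T.toModule.eq_tr_add_tr h _
  | res_tr a b c d h => exact T.res_tr _ _ _ _ h _
  | res_nm a b c d h => exact T.res_nm _ _ _ _ h _
  | nm_tr p f e f' q h => exact T.nm_tr _ _ _ _ _ h _
  | tr_res_mul => exact T.tr_res_mul _ _ _

/-- The morphism out of `presented E` with given values on the generators. -/
def presentedLift (T : TambaraFunctor G) (φ : ∀ X : FinGSet G, Γ X → T.obj X)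
    (hφ : ∀ (X : FinGSet G) (a b : Term Γ X), E X a b → a.eval T φ = b.eval T φ) :
    presented E ⟶ T where
  app X :=
    { toFun := Quotient.lift (fun a => a.eval T φ) fun _ _ h => Rel.eval_eq T φ hφ h
      map_one' := rfl
      map_mul' := by rintro ⟨a⟩ ⟨b⟩; rfl
      map_zero' := rfl
      map_add' := by rintro ⟨a⟩ ⟨b⟩; rfl }
  app_res := by rintro X Y f ⟨a⟩; rfl
  app_tr := by rintro X Y f ⟨a⟩; rfl
  app_nm := by rintro X Y f ⟨a⟩; rfl

end Presented

open Term in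
/-- The relations which make a family of maps `ι : T(X) → Γ(X)` a morphism of Tambara functors. -/
inductive HomRel (T : TambaraFunctor G) {Γ : FinGSet G → Type u}
    (ι : ∀ X : FinGSet G, T.obj X → Γ X) : ∀ X : FinGSet G, Term Γ X → Term Γ X → Prop
  | one (X : FinGSet G) : HomRel T ι X (of (ι X 1)) one
  | add (X : FinGSet G) (a b : T.obj X) :
      HomRel T ι X (of (ι X (a + b))) (add (of (ι X a)) (of (ι X b)))
  | mul (X : FinGSet G) (a b : T.obj X) :
      HomRel T ι X (of (ι X (a * b))) (mul (of (ι X a)) (of (ι X b)))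
  | res {X Y : FinGSet G} (f : X →[G] Y) (a : T.obj Y) :
      HomRel T ι X (of (ι X (T.res f a))) (resOp f (of (ι Y a)))
  | tr {X Y : FinGSet G} (f : X →[G] Y) (a : T.obj X) :
      HomRel T ι Y (of (ι Y (T.tr f a))) (trOp f (of (ι X a)))
  | nm {X Y : FinGSet G} (f : X →[G] Y) (a : T.obj X) :
      HomRel T ι Y (of (ι Y (T.nm f a))) (nmOp f (of (ι X a)))

/-- The morphism `T → presented E` given by generators, if `E` contains `HomRel T ι`. -/
def homOfRel (T : TambaraFunctor G) {Γ : FinGSet G → Type u}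
    (ι : ∀ X : FinGSet G, T.obj X → Γ X) (E : ∀ X : FinGSet G, Term Γ X → Term Γ X → Prop)
    (hE : ∀ (X : FinGSet G) (a b : Term Γ X), HomRel T ι X a b → E X a b) :
    T ⟶ presented E where
  app X := show T.obj X →+* PresentedObj E X from RingHom.mk'
    ⟨⟨fun a => Quotient.mk _ (Term.of (ι X a)),
      Quotient.sound (Rel.of (hE _ _ _ (HomRel.one X)))⟩,
      fun a b => Quotient.sound (Rel.of (hE _ _ _ (HomRel.mul X a b)))⟩
    (fun a b => Quotient.sound (Rel.of (hE _ _ _ (HomRel.add X a b))))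
  app_res f a := Quotient.sound (Rel.of (hE _ _ _ (HomRel.res f a)))
  app_tr f a := Quotient.sound (Rel.of (hE _ _ _ (HomRel.tr f a)))
  app_nm f a := Quotient.sound (Rel.of (hE _ _ _ (HomRel.nm f a)))

theorem HomRel.eval_eq {S T : TambaraFunctor G} {Γ : FinGSet G → Type u}
    {ι : ∀ X : FinGSet G, S.obj X → Γ X} (φ : ∀ X : FinGSet G, Γ X → T.obj X) (ψ : S ⟶ T)
    (hφ : ∀ (X : FinGSet G) (a : S.obj X), φ X (ι X a) = ψ.app X a)
    {X : FinGSet G} {a b : Term Γ X} (h : HomRel S ι X a b) : a.eval T φ = b.eval T φ := by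
  cases h with
  | one => simp only [Term.eval, hφ, map_one]
  | add => simp only [Term.eval, hφ, map_add]
  | mul => simp only [Term.eval, hφ, map_mul]
  | res => simp only [Term.eval, hφ, ψ.app_res]
  | tr => simp only [Term.eval, hφ, ψ.app_tr]
  | nm => simp only [Term.eval, hφ, ψ.app_nm]

/-! ## The relative box product of Tambara functors -/

/-- The relations of `R ⊠_k S`. -/
inductive BoxRel {k R S : TambaraFunctor G} (f : k ⟶ R) (g : k ⟶ S) : ∀ X : FinGSet G,
    Term (fun X => R.obj X ⊕ S.obj X) X → Term (fun X => R.obj X ⊕ S.obj X) X → Prop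
  | inl {X : FinGSet G} {a b : Term (fun X => R.obj X ⊕ S.obj X) X} :
      HomRel R (fun _ => Sum.inl) X a b → BoxRel f g X a b
  | inr {X : FinGSet G} {a b : Term (fun X => R.obj X ⊕ S.obj X) X} :
      HomRel S (fun _ => Sum.inr) X a b → BoxRel f g X a b
  | glue {X : FinGSet G} (c : k.obj X) :
      BoxRel f g X (Term.of (Sum.inl (f.app X c))) (Term.of (Sum.inr (g.app X c)))

/-- The relative box product `R ⊠_k S` of Tambara functors under `k`, i.e. the coproduct of the
`k`-algebras `R` and `S`. -/
def box {k R S : TambaraFunctor G} (f : k ⟶ R) (g : k ⟶ S) : TambaraFunctor G :=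
  presented (BoxRel f g)

/-- The morphism `R → R ⊠_k S`. -/
def boxInl {k R S : TambaraFunctor G} (f : k ⟶ R) (g : k ⟶ S) : R ⟶ box f g :=
  homOfRel R (fun _ => Sum.inl) _ fun _ _ _ h => BoxRel.inl h

/-- The morphism `S → R ⊠_k S`. -/
def boxInr {k R S : TambaraFunctor G} (f : k ⟶ R) (g : k ⟶ S) : S ⟶ box f g :=
  homOfRel S (fun _ => Sum.inr) _ fun _ _ _ h => BoxRel.inr h

/-- The morphism `R ⊠_k S → T` induced by morphisms `R → T` and `S → T` which agree on `k`. -/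
def boxDesc {k R S T : TambaraFunctor G} {f : k ⟶ R} {g : k ⟶ S} (a : R ⟶ T) (b : S ⟶ T)
    (w : f ≫ a = g ≫ b) : box f g ⟶ T :=
  presentedLift T (fun X => Sum.elim (a.app X) (b.app X)) (by
    intro X x y h
    cases h with
    | inl h => exact HomRel.eval_eq (fun X => Sum.elim (a.app X) (b.app X)) a (fun _ _ => rfl) h
    | inr h => exact HomRel.eval_eq (fun X => Sum.elim (a.app X) (b.app X)) b (fun _ _ => rfl) h
    | glue c => exact RingHom.congr_fun (congrFun (congrArg Hom.app w) X) c)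

/-- The multiplication map `R ⊠_k R → R`. -/
def boxMul {k R : TambaraFunctor G} (f : k ⟶ R) : box f f ⟶ R := boxDesc (𝟙 R) (𝟙 R) rfl

/-- `R ⊠_k S` is a pushout of Tambara functors. -/
theorem box_isPushout {k R S : TambaraFunctor G} (f : k ⟶ R) (g : k ⟶ S) :
    IsPushout f g (boxInl f g) (boxInr f g) := by
  refine ⟨⟨?_⟩, ⟨PushoutCocone.IsColimit.mk _ (fun s => boxDesc s.inl s.inr s.condition)
    (fun s => rfl) (fun s => rfl) ?_⟩⟩
  · apply Hom.ext
    funext X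
    ext c
    exact Quotient.sound (Rel.of (BoxRel.glue c))
  · intro s m hl hr
    apply Hom.ext
    funext X
    refine RingHom.ext (Quotient.ind fun t => ?_)
    change m.app X (Quotient.mk _ t) = t.eval _ _
    induction t with
    | of a =>
      rcases a with a | a
      · exact RingHom.congr_fun (congrFun (congrArg Hom.app hl) _) a
      · exact RingHom.congr_fun (congrFun (congrArg Hom.app hr) _) a
    | zero => exact map_zero (m.app _)
    | one => exact map_one (m.app _)
    | add a b ha hb =>
      exact (map_add (m.app _) _ _).trans (congrArg₂ (· + ·) ha hb)
    | mul a b ha hb =>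
      exact (map_mul (m.app _) _ _).trans (congrArg₂ (· * ·) ha hb)
    | neg a ha => exact (map_neg (m.app _) _).trans (congrArg (- ·) ha)
    | resOp f a ha => exact (m.app_res f _).trans (congrArg (TambaraFunctor.res _ f) ha)
    | trOp f a ha => exact (m.app_tr f _).trans (congrArg (TambaraFunctor.tr _ f) ha)
    | nmOp f a ha => exact (m.app_nm f _).trans (congrArg (TambaraFunctor.nm _ f) ha)

/-! ## Free polynomial algebras and finite presentation -/

/-- The generators of `k[x_1, …, x_n]`: constants, and a variable `x_i` in level `L i`. -/
inductive PolyGen (k : TambaraFunctor G) {n : ℕ} (L : Fin n → FinGSet G) : FinGSet G → Type u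
  | const {X : FinGSet G} (c : k.obj X) : PolyGen k L X
  | var (i : Fin n) : PolyGen k L (L i)

/-- The free polynomial `k`-algebra `k[x_1, …, x_n]` on generators `x_i` in levels `L i`. -/
def poly (k : TambaraFunctor G) {n : ℕ} (L : Fin n → FinGSet G) : Under k :=
  Under.mk (homOfRel k (Γ := PolyGen k L) (fun _ c => PolyGen.const c)
    (HomRel k fun _ c => PolyGen.const c) fun _ _ _ h => h)

/-- The variable `x_i` of `k[x_1, …, x_n]`. -/
def polyVar (k : TambaraFunctor G) {n : ℕ} (L : Fin n → FinGSet G) (i : Fin n) :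
    (poly k L).right.obj (L i) :=
  Quotient.mk (relSetoid (Γ := PolyGen k L) (HomRel k fun _ c => PolyGen.const c) (L i))
    (Term.of (PolyGen.var i))

/-- `k[x_1, …, x_n]` represents the functor `R ↦ R(L 1) × ⋯ × R(L n)` on `k`-algebras. -/
theorem poly_bijective (k : TambaraFunctor G) {n : ℕ} (L : Fin n → FinGSet G) (R : Under k) :
    Function.Bijective (fun (φ : poly k L ⟶ R) (i : Fin n) =>
      φ.right.app (L i) (polyVar k L i)) := by
  constructor
  · intro φ ψ h
    apply Under.UnderMorphism.ext
    apply Hom.ext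
    funext X
    refine RingHom.ext (Quotient.ind fun t => ?_)
    induction t with
    | of a =>
      cases a with
      | const c =>
        exact (RingHom.congr_fun (congrFun (congrArg Hom.app (Under.w φ)) _) c).trans
          (RingHom.congr_fun (congrFun (congrArg Hom.app (Under.w ψ)) _) c).symm
      | var i => exact congrFun h i
    | zero => exact (map_zero (φ.right.app _)).trans (map_zero (ψ.right.app _)).symm
    | one => exact (map_one (φ.right.app _)).trans (map_one (ψ.right.app _)).symm
    | add a b ha hb =>
      exact (map_add (φ.right.app _) _ _).trans ((congrArg₂ (· + ·) ha hb).trans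
        (map_add (ψ.right.app _) _ _).symm)
    | mul a b ha hb =>
      exact (map_mul (φ.right.app _) _ _).trans ((congrArg₂ (· * ·) ha hb).trans
        (map_mul (ψ.right.app _) _ _).symm)
    | neg a ha =>
      exact (map_neg (φ.right.app _) _).trans ((congrArg (- ·) ha).trans
        (map_neg (ψ.right.app _) _).symm)
    | resOp f a ha =>
      exact (φ.right.app_res f _).trans ((congrArg (TambaraFunctor.res _ f) ha).trans
        (ψ.right.app_res f _).symm)
    | trOp f a ha =>
      exact (φ.right.app_tr f _).trans ((congrArg (TambaraFunctor.tr _ f) ha).trans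
        (ψ.right.app_tr f _).symm)
    | nmOp f a ha =>
      exact (φ.right.app_nm f _).trans ((congrArg (TambaraFunctor.nm _ f) ha).trans
        (ψ.right.app_nm f _).symm)
  · intro x
    let val : ∀ X : FinGSet G, PolyGen k L X → R.right.obj X := fun X a =>
      match X, a with
      | X, .const c => R.hom.app X c
      | _, .var i => x i
    exact ⟨Under.homMk (U := poly k L) (V := R) (presentedLift R.right val
      fun X a b h => HomRel.eval_eq val R.hom (fun _ _ => rfl) h) rfl, rfl⟩

/-- A morphism `f : k → R` is finitely presented if the `k`-algebra `R` is a coequalizer of free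
polynomial `k`-algebras on finitely many generators. -/
def FinitelyPresented {k R : TambaraFunctor G} (f : k ⟶ R) : Prop :=
  ∃ (m n : ℕ) (K : Fin m → FinGSet G) (L : Fin n → FinGSet G) (a b : poly k K ⟶ poly k L)
    (c : poly k L ⟶ Under.mk f) (w : a ≫ c = b ≫ c), Nonempty (IsColimit (Cofork.ofπ c w))

/-! ## Ideals and genuine Kähler differentials -/

/-- A Tambara ideal of `T`. -/
@[ext]
structure TIdeal (T : TambaraFunctor G) : Type u where
  carrier : ∀ X : FinGSet G, Ideal (T.obj X)
  res_mem : ∀ {X Y : FinGSet G} (f : X →[G] Y) {a : T.obj Y},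
    a ∈ carrier Y → T.res f a ∈ carrier X
  tr_mem : ∀ {X Y : FinGSet G} (f : X →[G] Y) {a : T.obj X},
    a ∈ carrier X → T.tr f a ∈ carrier Y
  /-- `Nm_f(I(X)) ⊆ Nm_f(0) + I(Y)`. Here `Nm_f(0) = 0` if `f` is surjective. -/
  nm_mem : ∀ {X Y : FinGSet G} (f : X →[G] Y) {a : T.obj X},
    a ∈ carrier X → T.nm f a - T.nm f 0 ∈ carrier Y

namespace TIdeal

variable {T : TambaraFunctor G}

/-- The kernel of a morphism of Tambara functors. -/
def ker {S : TambaraFunctor G} (φ : T ⟶ S) : TIdeal T where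
  carrier X := RingHom.ker (φ.app X)
  res_mem f a h := by
    rw [RingHom.mem_ker] at h ⊢
    rw [φ.app_res, h, map_zero]
  tr_mem f a h := by
    rw [RingHom.mem_ker] at h ⊢
    rw [φ.app_tr, h, map_zero]
  nm_mem f a h := by
    rw [RingHom.mem_ker] at h ⊢
    rw [map_sub, φ.app_nm, φ.app_nm, h, map_zero (φ.app _), sub_self]

/-- The Tambara ideal generated by a family of subsets. -/
def span (s : ∀ X : FinGSet G, Set (T.obj X)) : TIdeal T where
  carrier X := ⨅ (J : TIdeal T) (_ : ∀ Y, s Y ⊆ J.carrier Y), J.carrier X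
  res_mem f a h := by
    simp only [Submodule.mem_iInf] at h ⊢
    exact fun J hJ => J.res_mem f (h J hJ)
  tr_mem f a h := by
    simp only [Submodule.mem_iInf] at h ⊢
    exact fun J hJ => J.tr_mem f (h J hJ)
  nm_mem f a h := by
    simp only [Submodule.mem_iInf] at h ⊢
    exact fun J hJ => J.nm_mem f (h J hJ)

/-- The products of two elements of `I`, and the nontrivial norms of elements of `I`, i.e. those
along maps `G/K → G/H` which are not isomorphisms. -/
inductive IsNorm (I : TIdeal T) : ∀ X : FinGSet G, T.obj X → Prop
  | mul {X : FinGSet G} (a b : T.obj X) : a ∈ I.carrier X → b ∈ I.carrier X → IsNorm I X (a * b)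
  | nm {X Y : FinGSet G} (f : X →[G] Y) (a : T.obj X) :
      Nonempty X → MulAction.IsPretransitive G X → MulAction.IsPretransitive G Y →
      ¬ Function.Bijective f → a ∈ I.carrier X → IsNorm I Y (T.nm f a)

/-- The Tambara ideal `I^{>1}` generated by the nontrivial norms (including products) of elements
of `I`. -/
def gtOne (I : TIdeal T) : TIdeal T := span fun X => {a | IsNorm I X a}

/-- The group `I(X) / J(X)`. -/
abbrev QuotObj (I J : TIdeal T) (X : FinGSet G) : Type u :=
  I.carrier X ⧸ (J.carrier X).submoduleOf (I.carrier X)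

/-- Restrictions in `I / J`. -/
def quotRes (I J : TIdeal T) {X Y : FinGSet G} (f : X →[G] Y) : QuotObj I J Y →+ QuotObj I J X :=
  QuotientAddGroup.map ((J.carrier Y).submoduleOf (I.carrier Y)).toAddSubgroup
    ((J.carrier X).submoduleOf (I.carrier X)).toAddSubgroup
    (AddMonoidHom.mk' (fun a => ⟨T.res f a, I.res_mem f a.2⟩)
      fun a b => Subtype.ext (map_add (T.res f) a.1 b.1))
    (fun a h => J.res_mem f (a := a.1) h)

/-- Transfers in `I / J`. -/
def quotTr (I J : TIdeal T) {X Y : FinGSet G} (f : X →[G] Y) : QuotObj I J X →+ QuotObj I J Y :=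
  QuotientAddGroup.map ((J.carrier X).submoduleOf (I.carrier X)).toAddSubgroup
    ((J.carrier Y).submoduleOf (I.carrier Y)).toAddSubgroup
    (AddMonoidHom.mk' (fun a => ⟨T.tr f a, I.tr_mem f a.2⟩)
      fun a b => Subtype.ext (map_add (T.tr f) a.1 b.1))
    (fun a h => J.tr_mem f (a := a.1) h)

/-- The `T`-module `I / J` (more precisely `I / (I ∩ J)`). -/
def quot (I J : TIdeal T) : TModule T where
  obj := QuotObj I J
  res := quotRes I J
  tr := quotTr I J
  res_id := by
    rintro X ⟨a⟩
    exact congrArg (Submodule.Quotient.mk) (Subtype.ext (T.res_id a.1))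
  tr_id := by
    rintro X ⟨a⟩
    exact congrArg (Submodule.Quotient.mk) (Subtype.ext (T.tr_id a.1))
  res_comp := by
    rintro X Y Z g f ⟨a⟩
    exact congrArg (Submodule.Quotient.mk) (Subtype.ext (T.res_comp g f a.1))
  tr_comp := by
    rintro X Y Z g f ⟨a⟩
    exact congrArg (Submodule.Quotient.mk) (Subtype.ext (T.tr_comp g f a.1))
  res_tr := by
    rintro W X Y Z a b c d h ⟨y⟩
    exact congrArg (Submodule.Quotient.mk) (Subtype.ext (T.res_tr a b c d h y.1))
  res_smul := by
    rintro X Y f c ⟨a⟩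
    exact congrArg (Submodule.Quotient.mk) (Subtype.ext (map_mul (T.res f) c a.1))
  tr_res_smul := by
    rintro X Y f c ⟨a⟩
    exact congrArg (Submodule.Quotient.mk) (Subtype.ext (T.tr_res_mul f c a.1))
  tr_smul_res := by
    rintro X Y f c ⟨a⟩
    exact congrArg (Submodule.Quotient.mk) (Subtype.ext (T.toModule.tr_smul_res f c a.1))
  bijective := by
    intro X Y Z i j h
    constructor
    · refine (injective_iff_map_eq_zero ((quotRes I J i).prod (quotRes I J j))).2 ?_
      rintro ⟨a⟩ ha
      obtain ⟨ha1, ha2⟩ := Prod.mk.inj ha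
      have h1 : (⟨T.res i a.1, I.res_mem i a.2⟩ : I.carrier X) ∈
          (J.carrier X).submoduleOf (I.carrier X) := (Submodule.Quotient.mk_eq_zero _).1 ha1
      have h2 : (⟨T.res j a.1, I.res_mem j a.2⟩ : I.carrier Y) ∈
          (J.carrier Y).submoduleOf (I.carrier Y) := (Submodule.Quotient.mk_eq_zero _).1 ha2
      refine (Submodule.Quotient.mk_eq_zero _).2 ?_
      change a.1 ∈ J.carrier Z
      have : a.1 = T.tr i (T.res i a.1) + T.tr j (T.res j a.1) := T.toModule.eq_tr_add_tr h a.1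
      rw [this]
      exact add_mem (J.tr_mem i h1) (J.tr_mem j h2)
    · rintro ⟨⟨a⟩, ⟨b⟩⟩
      obtain ⟨c, hc⟩ := (T.bijective i j h).2 (a.1, b.1)
      obtain ⟨hc1, hc2⟩ := Prod.mk.inj hc
      have hcI : c ∈ I.carrier Z := by
        have : c = T.tr i (T.res i c) + T.tr j (T.res j c) := T.toModule.eq_tr_add_tr h c
        rw [this, hc1, hc2]
        exact add_mem (I.tr_mem i a.2) (I.tr_mem j b.2)
      exact ⟨Submodule.Quotient.mk ⟨c, hcI⟩, Prod.ext
        (congrArg Submodule.Quotient.mk (Subtype.ext hc1))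
        (congrArg Submodule.Quotient.mk (Subtype.ext hc2))⟩

end TIdeal

/-- The `R`-module of genuine Kähler differentials `I / I^{>1}` of `f : k → R`, where `I` is the
kernel of `R ⊠_k R → R`. -/
def kaehler {k R : TambaraFunctor G} (f : k ⟶ R) : TModule R :=
  ((TIdeal.ker (boxMul f)).quot (TIdeal.ker (boxMul f)).gtOne).restrictScalars (boxInl f f)

/-! ## Étale morphisms -/

/-- `f : k → R` is flat if `R` is flat as a `k`-module. -/
def Flat {k R : TambaraFunctor G} (f : k ⟶ R) : Prop :=
  (R.toModule.restrictScalars f).IsFlat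

/-- Formally étale morphisms. -/
def FormallyEtale {k R : TambaraFunctor G} (f : k ⟶ R) : Prop :=
  (kaehler f).IsZero ∧ Flat f

/-- Étale morphisms. -/
def Etale {k R : TambaraFunctor G} (f : k ⟶ R) : Prop :=
  FormallyEtale f ∧ FinitelyPresented f

end TambaraFunctor

/-! The three statements are proved independently, and the claim about étale morphisms combines
them.

Kähler differentials. Let `J` be the kernel of the multiplication `S ⊠_k S → S` and let `Q` be the
quotient of `S ⊠_k S` by `J^{>1}`. The kernel of `R ⊠_k R → R` equals its own `>1` part, so it maps
into `J^{>1}`. Hence the two maps `R → Q` agree, and `S ⊠_k S → Q` factors through `δ : S ⊠_R S →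
Q`. The kernel of `S ⊠_R S → S` is contained in its own `>1` part, whose generators lift to
generators of `J^{>1}`, so `δ` kills it. Therefore `J` dies in `Q`, that is, `J ⊆ J^{>1}`
(`kaehler_comp_isZero`). The point that needs work is that norms descend to a quotient by a Tambara
ideal. This follows from the expansion of a norm of a sum, which comes from the exponential diagram
of a fold map (`isExponential_fold`, `TIdeal.nm_add_sub_mem`).

Flatness. `S ⊠_k A` is a natural retract of `S ⊠_R (R ⊠_k A)`, and a retract of an exact sequence is
exact (`Flat.comp`). The work lies in making `R ⊠_k A` an `R`-module. An element `r` of `R(X)` lives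
at a single level, so multiplication by `r` is not a morphism of `k`-modules and the universal
property does not give it directly. The external product with `r`, from `(R ⊠_k A)(Y)` to `(R ⊠_k
A)(Y × X)`, is a morphism in `Y`. The action is this product at `Y = X`, restricted along the
diagonal. Its properties are checked on symbols `r ⊗ a`, which generate under sums and transfers
(`BoxGenerated.all`).

Finite presentation. A coequalizer of finite polynomial algebras is the same as a presentation by
finitely many generators and relations (`IsPresentation`). A presentation of `S` over `R` is joined
to one of `R` over `k` by rewriting the coefficients in `R` as expressions in the generators of `R`
(`IsPresentation.comp`). -/

/-! ## Constructions of finite `G`-sets -/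

namespace FinGSet

variable {G : Type u} [Group G]

/-- A finite `G`-set isomorphic to `A`. -/
noncomputable def ofType (G : Type u) [Group G] (A : Type v) [Finite A] [MulAction G A] :
    FinGSet G :=
  (exists_equiv (G := G) A).choose

section ofType

variable (G) (A : Type v) [Finite A] [MulAction G A]

/-- The isomorphism `A ≃ ofType G A`. -/
noncomputable def ofTypeEquiv : A ≃ ofType G A := (exists_equiv (G := G) A).choose_spec.choose

theorem ofTypeEquiv_smul (g : G) (a : A) : ofTypeEquiv G A (g • a) = g • ofTypeEquiv G A a :=
  (exists_equiv (G := G) A).choose_spec.choose_spec g a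

/-- `ofTypeEquiv` as an equivariant map. -/
noncomputable def toOfType : A →[G] ofType G A where
  toFun := ofTypeEquiv G A
  map_smul' := ofTypeEquiv_smul G A

/-- The inverse of `ofTypeEquiv` as an equivariant map. -/
noncomputable def fromOfType : ofType G A →[G] A where
  toFun := (ofTypeEquiv G A).symm
  map_smul' g a := by
    rw [Equiv.symm_apply_eq, ofTypeEquiv_smul, Equiv.apply_symm_apply]; rfl

variable {G A}

@[simp] theorem fromOfType_toOfType (a : A) : fromOfType G A (toOfType G A a) = a :=
  (ofTypeEquiv G A).symm_apply_apply a

theorem toOfType_injective : Function.Injective (toOfType G A) := (ofTypeEquiv G A).injective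

theorem fromOfType_injective : Function.Injective (fromOfType G A) :=
  (ofTypeEquiv G A).symm.injective

theorem toOfType_surjective : Function.Surjective (toOfType G A) := (ofTypeEquiv G A).surjective

end ofType

@[simp] theorem toOfType_inj {A : Type v} [Finite A] [MulAction G A] {a b : A} :
    toOfType G A a = toOfType G A b ↔ a = b :=
  toOfType_injective.eq_iff

@[simp] theorem mulActionHom_mk_apply {G A B : Type*} [SMul G A] [SMul G B] (φ : A → B)
    (h : ∀ (g : G) (a : A), φ (g • a) = g • φ a) (a : A) : (⟨φ, h⟩ : A →[G] B) a = φ a :=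
  rfl

open scoped Pointwise

/-! ### The exponential diagram of a fold map `X ⊔ X → X`. -/

section Exponential

variable {X Y : FinGSet G} (f : X →[G] Y)

/-- The disjoint union of two copies of `X`. -/
noncomputable abbrev double (X : FinGSet G) : FinGSet G := ofType G (X ⊕ X)

/-- The first inclusion of `X` into `X ⊔ X`. -/
noncomputable def doubleInl (X : FinGSet G) : X →[G] double X :=
  (toOfType G (X ⊕ X)).comp ⟨Sum.inl, fun _ _ => rfl⟩

/-- The second inclusion of `X` into `X ⊔ X`. -/
noncomputable def doubleInr (X : FinGSet G) : X →[G] double X :=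
  (toOfType G (X ⊕ X)).comp ⟨Sum.inr, fun _ _ => rfl⟩

theorem isCoproduct_double (X : FinGSet G) : IsCoproduct (doubleInl X) (doubleInr X) := by
  have : Sum.elim (fun x => doubleInl X x) (fun y => doubleInr X y) = ofTypeEquiv G (X ⊕ X) := by
    ext x; cases x <;> rfl
  rw [IsCoproduct, this]
  exact (ofTypeEquiv G (X ⊕ X)).bijective

/-- The fold map `X ⊔ X → X`. -/
noncomputable def fold (X : FinGSet G) : double X →[G] X :=
  MulActionHom.comp (⟨Sum.elim id id, by rintro g (x | x) <;> rfl⟩ : (X ⊕ X) →[G] X)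
    (fromOfType G (X ⊕ X))

@[simp] theorem fold_doubleInl (x : X) : fold X (doubleInl X x) = x := by
  simp [fold, doubleInl]
  rfl

@[simp] theorem fold_doubleInr (x : X) : fold X (doubleInr X x) = x := by
  simp [fold, doubleInr]
  rfl

/-- Pairs of a point `y` of `Y` and a subset of the fibre at `y`. -/
def fibreSubsets : SubMulAction G (Y × Set X) where
  carrier := {z | ∀ u ∈ z.2, f u = z.1}
  smul_mem' g z hz := by
    rintro _ ⟨u, hu, rfl⟩
    exact (map_smul f g u).trans (congrArg (g • ·) (hz u hu))

/-- Pairs of a point `x` of `X` and a subset of the fibre which contains `x`. -/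
def pointedFibreSubsets : SubMulAction G (X × Set X) where
  carrier := {z | ∀ u ∈ z.2, f u = f z.1}
  smul_mem' g z hz := by
    rintro _ ⟨u, hu, rfl⟩
    exact (map_smul f g u).trans ((congrArg (g • ·) (hz u hu)).trans (map_smul f g _).symm)

/-- The part of `pointedFibreSubsets` where the point lies outside the subset. -/
def outerSubsets : SubMulAction G (X × Set X) where
  carrier := {z | (∀ u ∈ z.2, f u = f z.1) ∧ z.1 ∉ z.2}
  smul_mem' g _ hz := ⟨(pointedFibreSubsets f).smul_mem g hz.1,
    fun h => hz.2 (Set.smul_mem_smul_set_iff.1 h)⟩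

/-- The part of `pointedFibreSubsets` where the point lies in the subset. -/
def innerSubsets : SubMulAction G (X × Set X) where
  carrier := {z | (∀ u ∈ z.2, f u = f z.1) ∧ z.1 ∈ z.2}
  smul_mem' g _ hz := ⟨(pointedFibreSubsets f).smul_mem g hz.1, Set.smul_mem_smul_set_iff.2 hz.2⟩

instance (A : Type v) [Finite A] [MulAction G A] (S : SubMulAction G A) : Finite S :=
  inferInstanceAs (Finite {a // a ∈ S})

/-- `Π_f (X ⊔ X)` -/
noncomputable abbrev expBase : FinGSet G := ofType G (fibreSubsets f)

/-- `X ×_Y Π_f (X ⊔ X)` -/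
noncomputable abbrev expTotal : FinGSet G := ofType G (pointedFibreSubsets f)

open Classical in
/-- The evaluation map of the exponential diagram of a fold map. -/
noncomputable def expEval : expTotal f →[G] double X :=
  (MulActionHom.comp (⟨fun z => if z.1.1 ∈ z.1.2 then doubleInr X z.1.1 else doubleInl X z.1.1, by
    intro g z
    have : (g • z).1.1 ∈ (g • z).1.2 ↔ z.1.1 ∈ z.1.2 := Set.smul_mem_smul_set_iff
    simp only [this]
    split_ifs
    · exact map_smul (doubleInr X) g _
    · exact map_smul (doubleInl X) g _⟩ : pointedFibreSubsets f →[G] double X)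
    (fromOfType G _))

/-- The projection `X ×_Y Π_f (X ⊔ X) → Π_f (X ⊔ X)`. -/
noncomputable def expProj : expTotal f →[G] expBase f :=
  (toOfType G _).comp (MulActionHom.comp (⟨fun z => ⟨(f z.1.1, z.1.2), z.2⟩, fun g _ =>
    Subtype.ext (Prod.ext (map_smul f g _) rfl)⟩ : pointedFibreSubsets f →[G] fibreSubsets f)
    (fromOfType G _))

/-- The projection `Π_f (X ⊔ X) → Y`. -/
noncomputable def expPoint : expBase f →[G] Y :=
  MulActionHom.comp (⟨fun z => z.1.1, fun _ _ => rfl⟩ : fibreSubsets f →[G] Y) (fromOfType G _)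

/-- The inclusion of `outerSubsets` into `pointedFibreSubsets`. -/
noncomputable def outerIncl : ofType G (outerSubsets f) →[G] expTotal f :=
  (toOfType G _).comp (MulActionHom.comp (⟨fun z => ⟨z.1, z.2.1⟩, fun _ _ => rfl⟩ :
    outerSubsets f →[G] pointedFibreSubsets f) (fromOfType G _))

/-- The inclusion of `innerSubsets` into `pointedFibreSubsets`. -/
noncomputable def innerIncl : ofType G (innerSubsets f) →[G] expTotal f :=
  (toOfType G _).comp (MulActionHom.comp (⟨fun z => ⟨z.1, z.2.1⟩, fun _ _ => rfl⟩ :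
    innerSubsets f →[G] pointedFibreSubsets f) (fromOfType G _))

/-- The point of an element of `outerSubsets`. -/
noncomputable def outerPoint : ofType G (outerSubsets f) →[G] X :=
  MulActionHom.comp (⟨fun z => z.1.1, fun _ _ => rfl⟩ : outerSubsets f →[G] X) (fromOfType G _)

/-- The point of an element of `innerSubsets`. -/
noncomputable def innerPoint : ofType G (innerSubsets f) →[G] X :=
  MulActionHom.comp (⟨fun z => z.1.1, fun _ _ => rfl⟩ : innerSubsets f →[G] X) (fromOfType G _)

/-- A subset of a fibre encodes the section that takes the second copy on the subset and the first
copy elsewhere. This identity and the next one let the two summands of a sum be read off separately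
on the outer and inner parts. -/
theorem expEval_comp_outerIncl :
    (expEval f).comp (outerIncl f) = (doubleInl X).comp (outerPoint f) := by
  ext z
  obtain ⟨z, rfl⟩ := toOfType_surjective z
  have := z.2.2
  simp [expEval, outerIncl, outerPoint, this]

theorem expEval_comp_innerIncl :
    (expEval f).comp (innerIncl f) = (doubleInr X).comp (innerPoint f) := by
  ext z
  obtain ⟨z, rfl⟩ := toOfType_surjective z
  have := z.2.2
  simp [expEval, innerIncl, innerPoint, this]

/-- This splitting turns the norm along `expProj` into a product of two norms, one for each summand.
-/
theorem isCoproduct_outer_inner : IsCoproduct (outerIncl f) (innerIncl f) := by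
  constructor
  · rintro (a | a) (b | b) h <;> obtain ⟨a, rfl⟩ := toOfType_surjective a <;>
      obtain ⟨b, rfl⟩ := toOfType_surjective b <;>
      simp only [Sum.elim_inl, Sum.elim_inr, outerIncl, innerIncl, MulActionHom.comp_apply,
        fromOfType_toOfType, toOfType_inj, mulActionHom_mk_apply, Subtype.mk.injEq] at h
    · rw [Subtype.ext h]
    · exact absurd (h ▸ b.2.2) a.2.2
    · exact absurd (h ▸ a.2.2) b.2.2
    · rw [Subtype.ext h]
  · intro z
    obtain ⟨z, rfl⟩ := toOfType_surjective z
    by_cases h : z.1.1 ∈ z.1.2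
    · exact ⟨Sum.inr (toOfType G _ ⟨z.1, z.2, h⟩), by simp [innerIncl]⟩
    · exact ⟨Sum.inl (toOfType G _ ⟨z.1, z.2, h⟩), by simp [outerIncl]⟩

theorem expEval_toOfType_of_mem (z : pointedFibreSubsets f) (h : z.1.1 ∈ z.1.2) :
    expEval f (toOfType G _ z) = doubleInr X z.1.1 := by
  simp [expEval, h]

theorem expEval_toOfType_of_notMem (z : pointedFibreSubsets f) (h : z.1.1 ∉ z.1.2) :
    expEval f (toOfType G _ z) = doubleInl X z.1.1 := by
  simp [expEval, h]

theorem fold_expEval (z : pointedFibreSubsets f) : fold X (expEval f (toOfType G _ z)) = z.1.1 := by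
  by_cases h : z.1.1 ∈ z.1.2
  · rw [expEval_toOfType_of_mem f z h, fold_doubleInr]
  · rw [expEval_toOfType_of_notMem f z h, fold_doubleInl]

theorem expProj_toOfType (z : pointedFibreSubsets f) :
    expProj f (toOfType G _ z) = toOfType G (fibreSubsets f) ⟨(f z.1.1, z.1.2), z.2⟩ := by
  simp [expProj]

theorem expPoint_toOfType (z : fibreSubsets f) : expPoint f (toOfType G _ z) = z.1.1 := by
  simp [expPoint]

theorem eq_of_fold_eq {a : double X} {x : X} (h : fold X a = x) :
    a = doubleInl X x ∨ a = doubleInr X x := by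
  obtain ⟨a | a, rfl⟩ := toOfType_surjective a
  · left; rw [← h]; exact congrArg (doubleInl X) (fold_doubleInl a).symm
  · right; rw [← h]; exact congrArg (doubleInr X) (fold_doubleInr a).symm

theorem doubleInl_ne_doubleInr (x y : X) : doubleInl X x ≠ doubleInr X y := fun h => by
  cases (toOfType_injective h)

/-- A section of the fold map over a fibre of `f` chooses one of two copies at each point, which
amounts to choosing a subset of the fibre. So the dependent product consists of pairs `(y, U)` with
`U` in the fibre at `y`, and its pullback to `X` consists of pairs `(x, U)` with `U` in the fibre
through `x`. -/
theorem isExponential_fold :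
    IsExponential (fold X) f (expEval f) (expProj f) (expPoint f) where
  isPullback :=
    { comm := by
        intro w
        obtain ⟨w, rfl⟩ := toOfType_surjective w
        rw [MulActionHom.comp_apply, fold_expEval, expProj_toOfType, expPoint_toOfType]
      existsUnique := by
        intro x z h
        obtain ⟨z, rfl⟩ := toOfType_surjective z
        rw [expPoint_toOfType] at h
        refine ⟨toOfType G _ ⟨(x, z.1.2), fun u hu => (z.2 u hu).trans h.symm⟩, ⟨?_, ?_⟩, ?_⟩
        · rw [MulActionHom.comp_apply, fold_expEval]
        · rw [expProj_toOfType]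
          exact congrArg _ (Subtype.ext (Prod.ext h rfl))
        · rintro w ⟨h1, h2⟩
          obtain ⟨w, rfl⟩ := toOfType_surjective w
          rw [MulActionHom.comp_apply, fold_expEval] at h1
          rw [expProj_toOfType] at h2
          have h2 := congrArg (fun z => z.1.2) (toOfType_injective h2)
          exact congrArg _ (Subtype.ext (Prod.ext h1 h2)) }
  existsUnique := by
    intro y s hs
    -- The subset attached to `s` is the set of points where `s` takes the second copy.
    refine ⟨toOfType G _ ⟨(y, {x | ∃ h : f x = y, s ⟨x, h⟩ = doubleInr X x}),
      fun u hu => hu.1⟩, ⟨expPoint_toOfType _ _, ?_⟩, ?_⟩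
    · intro b hb x hx
      obtain ⟨b, rfl⟩ := toOfType_surjective b
      rw [fold_expEval] at hx
      rw [expProj_toOfType] at hb
      have hb := congrArg (fun z => z.1.2) (toOfType_injective hb)
      obtain ⟨⟨b, U⟩, hU⟩ := b
      obtain ⟨x, hxy⟩ := x
      change U = _ at hb
      change b = x at hx
      subst hx
      by_cases h : b ∈ U
      · rw [expEval_toOfType_of_mem f _ h]
        rw [hb] at h
        exact h.2.symm
      · rw [expEval_toOfType_of_notMem f _ h]
        rcases eq_of_fold_eq (hs ⟨b, hxy⟩) with h' | h'
        · exact h'.symm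
        · exact absurd (hb ▸ ⟨hxy, h'⟩ : b ∈ U) h
    · rintro z ⟨h1, h2⟩
      obtain ⟨⟨⟨y', U⟩, hU⟩, rfl⟩ := toOfType_surjective z
      rw [expPoint_toOfType] at h1
      change y' = y at h1
      subst h1
      refine congrArg _ (Subtype.ext (Prod.ext rfl (Set.ext fun x => ?_)))
      -- The condition on the given point `(y', U)`, read at the point `(x, U)` above it, determines
      -- whether `x` lies in `U`.
      have key : ∀ hx : f x = y', expEval f (toOfType G _ ⟨(x, U), fun u hu =>
          (hU u hu).trans hx.symm⟩) = s ⟨x, hx⟩ := fun hx => by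
        refine h2 _ ?_ ⟨x, hx⟩ (fold_expEval _ _)
        rw [expProj_toOfType]
        exact congrArg _ (Subtype.ext (Prod.ext hx rfl))
      constructor
      · intro hx
        refine ⟨hU x hx, ?_⟩
        rw [← key, expEval_toOfType_of_mem _ _ hx]
      · rintro ⟨hx, hs'⟩
        by_contra hxU
        rw [← key hx, expEval_toOfType_of_notMem _ _ hxU] at hs'
        exact doubleInl_ne_doubleInr _ _ hs'

end Exponential

end FinGSet

/-! ## Norms of sums and quotients of Tambara functors -/

namespace TambaraFunctor

variable {G : Type u} [Group G] (T : TambaraFunctor G)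

theorem eq_tr_add_tr {X Y Z : FinGSet G} {i : X →[G] Z} {j : Y →[G] Z}
    (h : FinGSet.IsCoproduct i j) (a : T.obj Z) :
    a = T.tr i (T.res i a) + T.tr j (T.res j a) :=
  T.toModule.eq_tr_add_tr h a

/-- The multiplicative counterpart of `eq_tr_add_tr`: `c` is the product of the norms of its two
restrictions, since both sides restrict equally to each summand. -/
theorem nm_of_isCoproduct {X Y Z W : FinGSet G} {i : X →[G] Z} {j : Y →[G] Z}
    (h : FinGSet.IsCoproduct i j) (f : Z →[G] W) (c : T.obj Z) :
    T.nm f c = T.nm (f.comp i) (T.res i c) * T.nm (f.comp j) (T.res j c) := by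
  -- The ring at the empty set is zero, so the cross terms are norms of `1` from the empty set and
  -- contribute the factor `1`.
  have h0 (a b : T.obj (FinGSet.empty G)) : a = b :=
    (T.toModule.eq_zero_of_empty a).trans (T.toModule.eq_zero_of_empty b).symm
  have : c = T.nm i (T.res i c) * T.nm j (T.res j c) := by
    apply (T.bijective i j h).1
    simp only [map_mul]
    rw [T.res_nm _ _ _ _ h.isPullback_left, T.res_nm _ _ _ _ h.symm.isPullback_left,
      T.res_nm _ _ _ _ h.isPullback_empty, T.res_nm _ _ _ _ h.symm.isPullback_empty,
      h0 (T.res _ (T.res j c)) 1, h0 (T.res _ (T.res i c)) 1]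
    simp [T.res_id, T.nm_id]
  conv_lhs => rw [this]
  rw [map_mul, T.nm_comp, T.nm_comp]

variable {T}

/-- The norm of `a + b` is a transfer, over pairs `(y, U)`, of the norm of `a` outside `U` times the
norm of `b` inside `U`. Subtracting the same formula with `b = 0` leaves a transfer of multiples of
`Nm(b) - Nm(0)`, which lies in `I`. The term `Nm(0)` cannot be dropped, because the inner part is
empty over `U = ∅`. The result says that norms are well defined modulo `I`. -/
theorem TIdeal.nm_add_sub_mem (I : TIdeal T) {X Y : FinGSet G} (f : X →[G] Y) (a : T.obj X)
    {b : T.obj X} (hb : b ∈ I.carrier X) : T.nm f (a + b) - T.nm f a ∈ I.carrier Y := by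
  have hd := FinGSet.isCoproduct_double X
  have key (b : T.obj X) : T.nm f (a + b) = T.tr (FinGSet.expPoint f)
      (T.nm ((FinGSet.expProj f).comp (FinGSet.outerIncl f)) (T.res (FinGSet.outerPoint f) a) *
        T.nm ((FinGSet.expProj f).comp (FinGSet.innerIncl f))
          (T.res (FinGSet.innerPoint f) b)) := by
    -- The element `c` over `X ⊔ X` has components `a` and `b`, so `a + b` is its transfer along the
    -- fold map and distributivity applies.
    obtain ⟨c, hc⟩ := (T.bijective _ _ hd).2 (a, b)
    simp only [Prod.mk.injEq] at hc
    have hl : (FinGSet.fold X).comp (FinGSet.doubleInl X) = MulActionHom.id G := by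
      ext x; simp
    have hr : (FinGSet.fold X).comp (FinGSet.doubleInr X) = MulActionHom.id G := by
      ext x; simp
    have : a + b = T.tr (FinGSet.fold X) c := by
      rw [T.eq_tr_add_tr hd c, map_add, ← T.tr_comp, ← T.tr_comp, hl, hr, T.tr_id,
        T.tr_id, hc.1, hc.2]
    rw [this, T.nm_tr _ _ _ _ _ (FinGSet.isExponential_fold f),
      T.nm_of_isCoproduct (FinGSet.isCoproduct_outer_inner f), ← T.res_comp, ← T.res_comp,
      FinGSet.expEval_comp_outerIncl, FinGSet.expEval_comp_innerIncl, T.res_comp, T.res_comp,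
      hc.1, hc.2]
  have h0 := key 0
  rw [add_zero, map_zero] at h0
  rw [key b, h0, ← map_sub, ← mul_sub]
  exact I.tr_mem _ (Ideal.mul_mem_left _ _ (I.nm_mem _ (I.res_mem _ hb)))

/-- The values of `T / I`. -/
abbrev TIdeal.Residue (I : TIdeal T) (X : FinGSet G) : Type u := T.obj X ⧸ I.carrier X

/-- The quotient of a Tambara functor by a Tambara ideal. -/
def TIdeal.residue (I : TIdeal T) : TambaraFunctor G where
  obj := I.Residue
  res f := Ideal.quotientMap _ (T.res f) fun _ h => I.res_mem f h
  tr {X Y} f := QuotientAddGroup.map (I.carrier X).toAddSubgroup (I.carrier Y).toAddSubgroup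
    (T.tr f) fun _ h => I.tr_mem f h
  nm {X Y} f :=
    { toFun := Quotient.map (T.nm f) fun a b h => by
        have h := (Submodule.quotientRel_def _).1 h
        have := I.nm_add_sub_mem f b h
        rw [add_sub_cancel] at this
        exact (Submodule.quotientRel_def _).2 this
      map_one' := congrArg (Ideal.Quotient.mk _) (map_one (T.nm f))
      map_mul' := by
        rintro ⟨a⟩ ⟨b⟩; exact congrArg (Ideal.Quotient.mk _) (map_mul (T.nm f) a b) }
  res_id := by rintro X ⟨a⟩; exact congrArg (Ideal.Quotient.mk _) (T.res_id a)
  tr_id := by rintro X ⟨a⟩; exact congrArg (Ideal.Quotient.mk _) (T.tr_id a)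
  nm_id := by rintro X ⟨a⟩; exact congrArg (Ideal.Quotient.mk _) (T.nm_id a)
  res_comp := by rintro X Y Z g f ⟨a⟩; exact congrArg (Ideal.Quotient.mk _) (T.res_comp g f a)
  tr_comp := by rintro X Y Z g f ⟨a⟩; exact congrArg (Ideal.Quotient.mk _) (T.tr_comp g f a)
  nm_comp := by rintro X Y Z g f ⟨a⟩; exact congrArg (Ideal.Quotient.mk _) (T.nm_comp g f a)
  res_tr := by
    rintro W X Y Z a b c d h ⟨y⟩; exact congrArg (Ideal.Quotient.mk _) (T.res_tr a b c d h y)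
  res_nm := by
    rintro W X Y Z a b c d h ⟨y⟩; exact congrArg (Ideal.Quotient.mk _) (T.res_nm a b c d h y)
  nm_tr := by
    rintro A B P X Y p f e f' q h ⟨a⟩
    exact congrArg (Ideal.Quotient.mk _) (T.nm_tr p f e f' q h a)
  tr_res_mul := by
    rintro X Y f ⟨c⟩ ⟨a⟩; exact congrArg (Ideal.Quotient.mk _) (T.tr_res_mul f c a)
  bijective := by
    intro X Y Z i j h
    constructor
    · rintro ⟨a⟩ ⟨b⟩ hab
      obtain ⟨h1, h2⟩ := Prod.mk.inj hab
      have h1 := Ideal.Quotient.eq.1 h1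
      have h2 := Ideal.Quotient.eq.1 h2
      refine Ideal.Quotient.eq.2 ?_
      rw [← map_sub] at h1 h2
      rw [T.eq_tr_add_tr h (a - b)]
      exact add_mem (I.tr_mem i h1) (I.tr_mem j h2)
    · rintro ⟨⟨a⟩, ⟨b⟩⟩
      obtain ⟨c, hc⟩ := (T.bijective i j h).2 (a, b)
      obtain ⟨hc1, hc2⟩ := Prod.mk.inj hc
      exact ⟨Ideal.Quotient.mk _ c, Prod.ext (congrArg (Ideal.Quotient.mk _) hc1)
        (congrArg (Ideal.Quotient.mk _) hc2)⟩

/-- The projection `T → T / I`. -/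
def TIdeal.toResidue (I : TIdeal T) : T ⟶ I.residue where
  app X := Ideal.Quotient.mk (I.carrier X)
  app_res _ _ := rfl
  app_tr _ _ := rfl
  app_nm _ _ := rfl

theorem TIdeal.toResidue_eq_zero_iff (I : TIdeal T) {X : FinGSet G} (a : T.obj X) :
    I.toResidue.app X a = 0 ↔ a ∈ I.carrier X :=
  Ideal.Quotient.eq_zero_iff_mem

end TambaraFunctor

/-! ## Kähler differentials of a composition -/

namespace TambaraFunctor

variable {G : Type u} [Group G]

theorem hom_comp_app {R S T : TambaraFunctor G} (φ : R ⟶ S) (ψ : S ⟶ T) {X : FinGSet G}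
    (a : R.obj X) : (φ ≫ ψ).app X a = ψ.app X (φ.app X a) :=
  rfl

/-- The image of a morphism is closed under every Tambara operation, so it suffices to reach the
generators. -/
theorem surjective_of_generators {Γ : FinGSet G → Type u}
    {E : ∀ X : FinGSet G, Term Γ X → Term Γ X → Prop} {U : TambaraFunctor G} (φ : U ⟶ presented E)
    (h : ∀ (X : FinGSet G) (a : Γ X), ∃ b, φ.app X b = Quotient.mk (relSetoid E X) (Term.of a))
    (X : FinGSet G) : Function.Surjective (φ.app X) := by
  refine Quotient.ind fun t => ?_
  induction t with
  | of a => exact h _ a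
  | zero => exact ⟨0, map_zero (φ.app _)⟩
  | one => exact ⟨1, map_one (φ.app _)⟩
  | add a b ha hb =>
    obtain ⟨x, hx⟩ := ha
    obtain ⟨y, hy⟩ := hb
    exact ⟨x + y, (map_add (φ.app _) _ _).trans (congrArg₂ (· + ·) hx hy)⟩
  | mul a b ha hb =>
    obtain ⟨x, hx⟩ := ha
    obtain ⟨y, hy⟩ := hb
    exact ⟨x * y, (map_mul (φ.app _) _ _).trans (congrArg₂ (· * ·) hx hy)⟩
  | neg a ha =>
    obtain ⟨x, hx⟩ := ha
    exact ⟨-x, (map_neg (φ.app _) _).trans (congrArg (- ·) hx)⟩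
  | resOp f a ha =>
    obtain ⟨x, hx⟩ := ha
    exact ⟨U.res f x, (φ.app_res f x).trans (congrArg (TambaraFunctor.res _ f) hx)⟩
  | trOp f a ha =>
    obtain ⟨x, hx⟩ := ha
    exact ⟨U.tr f x, (φ.app_tr f x).trans (congrArg (TambaraFunctor.tr _ f) hx)⟩
  | nmOp f a ha =>
    obtain ⟨x, hx⟩ := ha
    exact ⟨U.nm f x, (φ.app_nm f x).trans (congrArg (TambaraFunctor.nm _ f) hx)⟩

/-! ### Preimages of Tambara ideals and functoriality of `I^{>1}`. -/

namespace TIdeal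

variable {T U : TambaraFunctor G}

/-- The preimage of a Tambara ideal. -/
def comap (φ : T ⟶ U) (J : TIdeal U) : TIdeal T where
  carrier X := (J.carrier X).comap (φ.app X)
  res_mem f a h := by
    rw [Ideal.mem_comap] at h ⊢
    rw [φ.app_res]
    exact J.res_mem f h
  tr_mem f a h := by
    rw [Ideal.mem_comap] at h ⊢
    rw [φ.app_tr]
    exact J.tr_mem f h
  nm_mem f a h := by
    rw [Ideal.mem_comap] at h ⊢
    rw [map_sub, φ.app_nm, φ.app_nm, map_zero]
    exact J.nm_mem f h

theorem span_le {s : ∀ X : FinGSet G, Set (T.obj X)} {J : TIdeal T}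
    (h : ∀ X, s X ⊆ J.carrier X) (X : FinGSet G) : (span s).carrier X ≤ J.carrier X :=
  iInf₂_le J h

theorem subset_span (s : ∀ X : FinGSet G, Set (T.obj X)) (X : FinGSet G) :
    s X ⊆ (span s).carrier X := fun a ha => by
  change a ∈ (⨅ (J : TIdeal T) (_ : ∀ Y, s Y ⊆ J.carrier Y), J.carrier X)
  simp only [Submodule.mem_iInf]
  exact fun J hJ => hJ X ha

theorem IsNorm.mem_gtOne {I : TIdeal T} {X : FinGSet G} {a : T.obj X} (h : IsNorm I X a) :
    a ∈ I.gtOne.carrier X :=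
  subset_span (fun X => {a | IsNorm I X a}) X h

theorem gtOne_le {I J : TIdeal T} (h : ∀ (X : FinGSet G) (a : T.obj X), IsNorm I X a →
    a ∈ J.carrier X) (X : FinGSet G) : I.gtOne.carrier X ≤ J.carrier X :=
  span_le h X

theorem IsNorm.map {I : TIdeal T} {J : TIdeal U} (φ : T ⟶ U)
    (h : ∀ X, I.carrier X ≤ (J.carrier X).comap (φ.app X)) {X : FinGSet G} {a : T.obj X}
    (ha : IsNorm I X a) : IsNorm J X (φ.app X a) := by
  cases ha with
  | mul a b ha hb => rw [map_mul]; exact IsNorm.mul _ _ (h _ ha) (h _ hb)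
  | nm f a h1 h2 h3 h4 ha => rw [φ.app_nm]; exact IsNorm.nm f _ h1 h2 h3 h4 (h _ ha)

/-- The arguments of the product or norm are lifted, and the same operation is performed upstairs.
Along `S ⊠_k S → S ⊠_R S` this transports generators of the `>1` ideal backwards. -/
theorem IsNorm.exists_of_surjective {I : TIdeal T} {J : TIdeal U} (φ : T ⟶ U)
    (h : ∀ (X : FinGSet G) (b : U.obj X), b ∈ J.carrier X → ∃ a ∈ I.carrier X, φ.app X a = b)
    {X : FinGSet G} {b : U.obj X} (hb : IsNorm J X b) : ∃ a, IsNorm I X a ∧ φ.app X a = b := by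
  cases hb with
  | mul b b' hb hb' =>
    obtain ⟨a, ha, rfl⟩ := h _ _ hb
    obtain ⟨a', ha', rfl⟩ := h _ _ hb'
    exact ⟨a * a', IsNorm.mul _ _ ha ha', map_mul _ _ _⟩
  | nm f b h1 h2 h3 h4 hb =>
    obtain ⟨a, ha, rfl⟩ := h _ _ hb
    exact ⟨T.nm f a, IsNorm.nm f _ h1 h2 h3 h4 ha, φ.app_nm _ _⟩

end TIdeal

/-- `TIdeal.quot` is `I / (I ∩ J)`, so the inclusion of `I` in `I^{>1}` is the whole condition and
the reverse inclusion is not needed. -/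
theorem kaehler_isZero_iff {k R : TambaraFunctor G} (f : k ⟶ R) :
    (kaehler f).IsZero ↔ ∀ X, (TIdeal.ker (boxMul f)).carrier X ≤
      (TIdeal.ker (boxMul f)).gtOne.carrier X := by
  refine forall_congr' fun X => ?_
  change Subsingleton (TIdeal.QuotObj _ _ X) ↔ _
  rw [Submodule.Quotient.subsingleton_iff, Submodule.submoduleOf,
    Submodule.comap_subtype_eq_top]

theorem box_hom_ext {k R S T : TambaraFunctor G} {f : k ⟶ R} {g : k ⟶ S} {φ ψ : box f g ⟶ T}
    (hl : boxInl f g ≫ φ = boxInl f g ≫ ψ) (hr : boxInr f g ≫ φ = boxInr f g ≫ ψ) : φ = ψ :=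
  (box_isPushout f g).hom_ext hl hr

theorem box_condition {k R S : TambaraFunctor G} (f : k ⟶ R) (g : k ⟶ S) :
    f ≫ boxInl f g = g ≫ boxInr f g :=
  (box_isPushout f g).w

/-! ### The maps `R ⊠_k R → S ⊠_k S → S ⊠_R S` and vanishing of differentials. -/

variable {k R S : TambaraFunctor G} (f : k ⟶ R) (g : R ⟶ S)

/-- The morphism `R ⊠_k R → S ⊠_k S`. -/
def boxSelfMap : box f f ⟶ box (f ≫ g) (f ≫ g) :=
  boxDesc (g ≫ boxInl _ _) (g ≫ boxInr _ _) (box_condition (f ≫ g) (f ≫ g))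

/-- The morphism `S ⊠_k S → S ⊠_R S`. -/
def boxChangeBase : box (f ≫ g) (f ≫ g) ⟶ box g g :=
  boxDesc (boxInl g g) (boxInr g g) (by rw [Category.assoc, Category.assoc, box_condition])

theorem boxSelfMap_boxMul : boxSelfMap f g ≫ boxMul (f ≫ g) = boxMul f ≫ g :=
  box_hom_ext rfl rfl

theorem boxChangeBase_boxMul : boxChangeBase f g ≫ boxMul g = boxMul (f ≫ g) :=
  box_hom_ext rfl rfl

/-- Both sides are generated by the same two copies of `S`; only the gluing relations differ. -/
theorem boxChangeBase_surjective (X : FinGSet G) :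
    Function.Surjective ((boxChangeBase f g).app X) := by
  refine surjective_of_generators (boxChangeBase f g) ?_ X
  rintro X (a | a)
  · exact ⟨(boxInl (f ≫ g) (f ≫ g)).app X a, rfl⟩
  · exact ⟨(boxInr (f ≫ g) (f ≫ g)).app X a, rfl⟩

theorem boxInl_sub_boxInr_mem_ker {X : FinGSet G} (r : R.obj X) :
    (boxInl f f).app X r - (boxInr f f).app X r ∈ (TIdeal.ker (boxMul f)).carrier X := by
  change (boxMul f).app X _ = 0
  rw [map_sub]
  exact sub_self r

theorem kaehler_comp_isZero (hg : (kaehler g).IsZero) (hf : (kaehler f).IsZero) :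
    (kaehler (f ≫ g)).IsZero := by
  rw [kaehler_isZero_iff] at hf hg ⊢
  set J := TIdeal.ker (boxMul (f ≫ g)) with hJ
  set q := J.gtOne.toResidue with hq
  -- Vanishing of the differentials of `f` replaces the kernel by its `>1` part, and a morphism
  -- sends generating norms and products to norms and products in `J`.
  have hle (X : FinGSet G) : (TIdeal.ker (boxMul f)).carrier X ≤
      (J.gtOne.comap (boxSelfMap f g)).carrier X := by
    refine (hf X).trans (TIdeal.gtOne_le (fun X a ha => ?_) X)
    refine (ha.map (boxSelfMap f g) fun X b hb => ?_).mem_gtOne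
    have hb : (boxMul f).app X b = 0 := hb
    change (boxMul (f ≫ g)).app X ((boxSelfMap f g).app X b) = 0
    rw [← hom_comp_app, boxSelfMap_boxMul, hom_comp_app, hb, map_zero]
  -- The differences `r ⊗ 1 - 1 ⊗ r` lie in the kernel for `f`, so they vanish in the quotient. This
  -- is the condition for a map out of `S ⊠_R S`.
  have w : g ≫ boxInl (f ≫ g) (f ≫ g) ≫ q = g ≫ boxInr (f ≫ g) (f ≫ g) ≫ q := by
    apply Hom.ext
    funext X
    ext r
    have h := (J.gtOne.toResidue_eq_zero_iff _).2 (hle X (boxInl_sub_boxInr_mem_ker f r))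
    rw [map_sub, map_sub, sub_eq_zero] at h
    exact h
  set δ := boxDesc _ _ w with hδ
  have hδq : boxChangeBase f g ≫ δ = q := box_hom_ext rfl rfl
  -- By the hypothesis on `g` only the generating norms and products need checking. Each lifts to
  -- one formed from elements of `J`, which `q` kills.
  have hker (X : FinGSet G) : (TIdeal.ker (boxMul g)).carrier X ≤ (TIdeal.ker δ).carrier X := by
    refine (hg X).trans (TIdeal.gtOne_le (fun X b hb => ?_) X)
    obtain ⟨a, ha, rfl⟩ := hb.exists_of_surjective (I := J) (boxChangeBase f g) fun X b hb => by
      obtain ⟨a, rfl⟩ := boxChangeBase_surjective f g X b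
      refine ⟨a, ?_, rfl⟩
      change (boxMul (f ≫ g)).app X a = 0
      rw [← boxChangeBase_boxMul]
      exact hb
    change δ.app X _ = 0
    rw [← hom_comp_app, hδq]
    exact (J.gtOne.toResidue_eq_zero_iff _).2 ha.mem_gtOne
  intro X x hx
  rw [← TIdeal.toResidue_eq_zero_iff, ← hq, ← hδq]
  refine hker X ?_
  have hx : (boxMul (f ≫ g)).app X x = 0 := hx
  rw [← boxChangeBase_boxMul] at hx
  exact hx

end TambaraFunctor

/-! ## Products and pullbacks of finite `G`-sets -/

namespace FinGSet

variable {G : Type u} [Group G]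

/-- The product of two finite `G`-sets. -/
noncomputable def prod (X Y : FinGSet G) : FinGSet G := ofType G (X × Y)

/-- The first projection. -/
noncomputable def fst (X Y : FinGSet G) : prod X Y →[G] X :=
  MulActionHom.comp (⟨Prod.fst, fun _ _ => rfl⟩ : (X × Y) →[G] X) (fromOfType G (X × Y))

/-- The second projection. -/
noncomputable def snd (X Y : FinGSet G) : prod X Y →[G] Y :=
  MulActionHom.comp (⟨Prod.snd, fun _ _ => rfl⟩ : (X × Y) →[G] Y) (fromOfType G (X × Y))

/-- The map to a product with given components. -/
noncomputable def lift {W X Y : FinGSet G} (a : W →[G] X) (b : W →[G] Y) : W →[G] prod X Y :=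
  (toOfType G (X × Y)).comp (⟨fun w => (a w, b w), fun g w =>
    Prod.ext (map_smul a g w) (map_smul b g w)⟩ : W →[G] (X × Y))

@[simp] theorem fst_lift {W X Y : FinGSet G} (a : W →[G] X) (b : W →[G] Y) (w : W) :
    fst X Y (lift a b w) = a w :=
  congrArg Prod.fst (fromOfType_toOfType (G := G) (a w, b w))

@[simp] theorem snd_lift {W X Y : FinGSet G} (a : W →[G] X) (b : W →[G] Y) (w : W) :
    snd X Y (lift a b w) = b w :=
  congrArg Prod.snd (fromOfType_toOfType (G := G) (a w, b w))

theorem prod_ext {X Y : FinGSet G} {z w : prod X Y} (h : fst X Y z = fst X Y w)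
    (h' : snd X Y z = snd X Y w) : z = w :=
  fromOfType_injective (Prod.ext h h')

theorem exists_prod {X Y : FinGSet G} (x : X) (y : Y) :
    ∃ z : prod X Y, fst X Y z = x ∧ snd X Y z = y :=
  ⟨toOfType G (X × Y) (x, y), congrArg Prod.fst (fromOfType_toOfType (G := G) (x, y)),
    congrArg Prod.snd (fromOfType_toOfType (G := G) (x, y))⟩

/-- The product of two maps. -/
noncomputable def map {X X' Y Y' : FinGSet G} (a : X →[G] X') (b : Y →[G] Y') :
    prod X Y →[G] prod X' Y' :=
  lift (a.comp (fst X Y)) (b.comp (snd X Y))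

@[simp] theorem fst_map {X X' Y Y' : FinGSet G} (a : X →[G] X') (b : Y →[G] Y')
    (z : prod X Y) : fst X' Y' (map a b z) = a (fst X Y z) :=
  fst_lift _ _ z

@[simp] theorem snd_map {X X' Y Y' : FinGSet G} (a : X →[G] X') (b : Y →[G] Y')
    (z : prod X Y) : snd X' Y' (map a b z) = b (snd X Y z) :=
  snd_lift _ _ z

/-- The product of a map with an identity map. -/
noncomputable abbrev mapLeft {X X' : FinGSet G} (a : X →[G] X') (Y : FinGSet G) :
    prod X Y →[G] prod X' Y :=
  map a (MulActionHom.id G)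

/-- The product of an identity map with a map. -/
noncomputable abbrev mapRight (X : FinGSet G) {Y Y' : FinGSet G} (b : Y →[G] Y') :
    prod X Y →[G] prod X Y' :=
  map (MulActionHom.id G) b

theorem fst_comp_mapLeft {X X' : FinGSet G} (a : X →[G] X') (Y : FinGSet G) :
    (fst X' Y).comp (mapLeft a Y) = a.comp (fst X Y) := by
  ext z; simp

theorem snd_comp_mapLeft {X X' : FinGSet G} (a : X →[G] X') (Y : FinGSet G) :
    (snd X' Y).comp (mapLeft a Y) = snd X Y := by
  ext z; simp

theorem fst_comp_mapRight (X : FinGSet G) {Y Y' : FinGSet G} (b : Y →[G] Y') :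
    (fst X Y').comp (mapRight X b) = fst X Y := by
  ext z; simp

theorem snd_comp_mapRight (X : FinGSet G) {Y Y' : FinGSet G} (b : Y →[G] Y') :
    (snd X Y').comp (mapRight X b) = b.comp (snd X Y) := by
  ext z; simp

theorem mapLeft_id (X Y : FinGSet G) : mapLeft (MulActionHom.id G : X →[G] X) Y =
    MulActionHom.id G := by
  ext z; exact prod_ext (by simp) (by simp)

theorem mapLeft_comp {X X' X'' : FinGSet G} (a' : X' →[G] X'') (a : X →[G] X') (Y : FinGSet G) :
    mapLeft (a'.comp a) Y = (mapLeft a' Y).comp (mapLeft a Y) := by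
  ext z; exact prod_ext (by simp) (by simp)

theorem IsCoproduct.mapLeft {X Y Z : FinGSet G} {i : X →[G] Z} {j : Y →[G] Z}
    (h : IsCoproduct i j) (V : FinGSet G) : IsCoproduct (mapLeft i V) (mapLeft j V) := by
  constructor
  · rintro (a | a) (b | b) hab <;>
      have h1 := congrArg (fst Z V) hab <;> have h2 := congrArg (snd Z V) hab <;>
      simp only [Sum.elim_inl, Sum.elim_inr, fst_map, snd_map, MulActionHom.id_apply] at h1 h2
    · rw [prod_ext (Sum.inl_injective (@h.1 (Sum.inl _) (Sum.inl _) h1)) h2]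
    · cases @h.1 (Sum.inl _) (Sum.inr _) h1
    · cases @h.1 (Sum.inr _) (Sum.inl _) h1
    · rw [prod_ext (Sum.inr_injective (@h.1 (Sum.inr _) (Sum.inr _) h1)) h2]
  · intro z
    obtain ⟨x | y, h⟩ := h.2 (fst Z V z)
    · obtain ⟨w, hw, hw'⟩ := exists_prod x (snd Z V z)
      exact ⟨Sum.inl w, prod_ext (by simpa [hw] using h) (by simpa using hw')⟩
    · obtain ⟨w, hw, hw'⟩ := exists_prod y (snd Z V z)
      exact ⟨Sum.inr w, prod_ext (by simpa [hw] using h) (by simpa using hw')⟩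

theorem IsPullback.mapLeft {W X Y Z : FinGSet G} {a : W →[G] X} {b : W →[G] Y}
    {c : X →[G] Z} {d : Y →[G] Z} (h : IsPullback a b c d) (V : FinGSet G) :
    IsPullback (mapLeft a V) (mapLeft b V) (mapLeft c V) (mapLeft d V) where
  comm w := prod_ext (by simpa using h.comm _) (by simp)
  existsUnique x y hxy := by
    have h1 := congrArg (fst Z V) hxy
    have h2 := congrArg (snd Z V) hxy
    simp only [fst_map, snd_map, MulActionHom.id_apply] at h1 h2
    obtain ⟨w, ⟨hw1, hw2⟩, hw⟩ := h.existsUnique _ _ h1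
    obtain ⟨z, hz, hz'⟩ := exists_prod w (snd X V x)
    refine ⟨z, ⟨prod_ext (by simp [hz, hw1]) (by simp [hz']),
      prod_ext (by simp [hz, hw2]) (by simp [hz', h2])⟩, ?_⟩
    rintro z' ⟨rfl, rfl⟩
    refine prod_ext ?_ (by simp [hz'])
    rw [hz]
    exact hw _ ⟨by simp, by simp⟩

theorem isPullback_mapLeft_fst {X X' : FinGSet G} (a : X →[G] X') (Y : FinGSet G) :
    IsPullback (mapLeft a Y) (fst X Y) (fst X' Y) a where
  comm w := by simp
  existsUnique z x h := by
    obtain ⟨w, hw, hw'⟩ := exists_prod x (snd X' Y z)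
    refine ⟨w, ⟨prod_ext (by simp [hw, h]) (by simp [hw']), hw⟩, ?_⟩
    rintro w' ⟨rfl, rfl⟩
    exact prod_ext hw.symm (by simp [hw'])

theorem isPullback_mapLeft_mapRight {X X' Y Y' : FinGSet G} (a : X →[G] X') (b : Y →[G] Y') :
    IsPullback (mapLeft a Y) (mapRight X b) (mapRight X' b) (mapLeft a Y') where
  comm w := prod_ext (by simp) (by simp)
  existsUnique z x h := by
    have h1 := congrArg (fst X' Y') h
    have h2 := congrArg (snd X' Y') h
    simp only [fst_map, snd_map, MulActionHom.id_apply] at h1 h2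
    obtain ⟨w, hw, hw'⟩ := exists_prod (fst X Y' x) (snd X' Y z)
    refine ⟨w, ⟨prod_ext (by simp [hw, h1]) (by simp [hw']),
      prod_ext (by simp [hw]) (by simp [hw', h2])⟩, ?_⟩
    rintro w' ⟨rfl, rfl⟩
    exact prod_ext (by simp [hw]) (by simp [hw'])

/-- The diagonal map. -/
noncomputable abbrev diag (X : FinGSet G) : X →[G] prod X X :=
  lift (MulActionHom.id G) (MulActionHom.id G)

/-- The graph `x ↦ (x, f x)` is the preimage of the diagonal of `Y` under `f × id`. Base change
along this square gives the projection formula `extendSMul_tr`. -/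
theorem isPullback_graph {X Y : FinGSet G} (f : X →[G] Y) :
    IsPullback f ((mapRight X f).comp (diag X)) (diag Y) (mapLeft f Y) where
  comm w := prod_ext (by simp) (by simp)
  existsUnique y z h := by
    have h1 := congrArg (fst Y Y) h
    have h2 := congrArg (snd Y Y) h
    simp only [fst_map, snd_map, fst_lift, snd_lift, MulActionHom.id_apply] at h1 h2
    refine ⟨fst X Y z, ⟨h1.symm, prod_ext (by simp) (by simp [← h1, h2])⟩, ?_⟩
    rintro w ⟨-, rfl⟩
    simp

theorem exists_isPullback {X Y Z : FinGSet G} (c : X →[G] Z) (d : Y →[G] Z) :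
    ∃ (W : FinGSet G) (a : W →[G] X) (b : W →[G] Y), IsPullback a b c d := by
  let S : SubMulAction G (X × Y) :=
    { carrier := {z | c z.1 = d z.2}
      smul_mem' := fun g z hz => (map_smul c g z.1).trans
        ((congrArg (g • ·) hz).trans (map_smul d g z.2).symm) }
  refine ⟨ofType G S,
    MulActionHom.comp (⟨fun z => z.1.1, fun _ _ => rfl⟩ : S →[G] X) (fromOfType G S),
    MulActionHom.comp (⟨fun z => z.1.2, fun _ _ => rfl⟩ : S →[G] Y) (fromOfType G S), ?_, ?_⟩
  · intro w
    exact (fromOfType G S w).2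
  · intro x y h
    refine ⟨toOfType G S ⟨(x, y), h⟩, ⟨by simp, by simp⟩, ?_⟩
    rintro w ⟨rfl, rfl⟩
    exact fromOfType_injective (by simp)

end FinGSet

/-! ## Extension of scalars -/

namespace TModule

variable {G : Type u} [Group G] {k R S : TambaraFunctor G}

/-- The `k`-module `Y ↦ M(Y × V)`. -/
noncomputable def shift (M : TModule k) (V : FinGSet G) : TModule k where
  obj Y := M.obj (Y.prod V)
  instModule Y := Module.compHom (M.obj (Y.prod V)) (k.res (FinGSet.fst Y V))
  res f := M.res (FinGSet.mapLeft f V)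
  tr f := M.tr (FinGSet.mapLeft f V)
  res_id a := by rw [FinGSet.mapLeft_id, M.res_id]
  tr_id a := by rw [FinGSet.mapLeft_id, M.tr_id]
  res_comp g f a := by rw [FinGSet.mapLeft_comp, M.res_comp]
  tr_comp g f a := by rw [FinGSet.mapLeft_comp, M.tr_comp]
  bijective _ _ h := M.bijective _ _ (h.mapLeft V)
  res_tr _ _ _ _ h := M.res_tr _ _ _ _ (h.mapLeft V)
  res_smul {X Y} f c m := by
    change M.res _ (k.res (FinGSet.fst Y V) c • m) = k.res (FinGSet.fst X V) (k.res f c) • _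
    rw [M.res_smul, ← k.res_comp, ← k.res_comp, FinGSet.fst_comp_mapLeft]
  tr_res_smul {X Y} f c m := by
    change M.tr (FinGSet.mapLeft f V) (k.res (FinGSet.fst X V) (k.res f c) • m) =
      k.res (FinGSet.fst Y V) c • M.tr (FinGSet.mapLeft f V) m
    rw [← M.tr_res_smul, ← k.res_comp, ← k.res_comp, FinGSet.fst_comp_mapLeft]
  tr_smul_res {X Y} f c m := by
    change M.tr (FinGSet.mapLeft f V) (k.res (FinGSet.fst X V) c • M.res (FinGSet.mapLeft f V) m) =
      k.res (FinGSet.fst Y V) (k.tr f c) • m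
    rw [M.tr_smul_res, k.res_tr _ _ _ _ (FinGSet.isPullback_mapLeft_fst f V)]

/-! ### Generation of a box product by transfers of symbols. -/

/-- The elements generated by symbols `m ⊗ n` under addition and transfers. -/
inductive BoxGenerated (M N : TModule k) : ∀ X : FinGSet G, (box M N).obj X → Prop
  | tmul {X : FinGSet G} (m : M.obj X) (n : N.obj X) :
      BoxGenerated M N X ((boxPairing M N).app X m n)
  | add {X : FinGSet G} {s t : (box M N).obj X} :
      BoxGenerated M N X s → BoxGenerated M N X t → BoxGenerated M N X (s + t)
  | tr {X Y : FinGSet G} (f : X →[G] Y) {s : (box M N).obj X} :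
      BoxGenerated M N X s → BoxGenerated M N Y ((box M N).tr f s)

namespace BoxGenerated

variable {M N : TModule k}

theorem neg {X : FinGSet G} {s : (box M N).obj X} (h : BoxGenerated M N X s) :
    BoxGenerated M N X (-s) := by
  induction h with
  | tmul m n =>
    have := BoxGenerated.tmul (M := M) (N := N) (-m) n
    rwa [map_neg, LinearMap.neg_apply] at this
  | add _ _ hs ht => rw [_root_.neg_add]; exact hs.add ht
  | tr f _ hs => rw [← map_neg]; exact hs.tr f

theorem smul {X : FinGSet G} {s : (box M N).obj X} (h : BoxGenerated M N X s) (c : k.obj X) :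
    BoxGenerated M N X (c • s) := by
  induction h with
  | tmul m n =>
    have := BoxGenerated.tmul (M := M) (N := N) (c • m) n
    rwa [map_smul, LinearMap.smul_apply] at this
  | add _ _ hs ht => rw [_root_.smul_add]; exact (hs c).add (ht c)
  | tr f _ hs => rw [← (box M N).tr_res_smul]; exact (hs _).tr f

/-- Base change moves a restriction past a transfer, so restrictions need no constructor of their
own. Scalars are absorbed likewise by Frobenius reciprocity. -/
theorem res {X Y : FinGSet G} (f : Y →[G] X) {s : (box M N).obj X} (h : BoxGenerated M N X s) :
    BoxGenerated M N Y ((box M N).res f s) := by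
  induction h generalizing Y with
  | tmul m n => rw [← (boxPairing M N).app_res]; exact .tmul _ _
  | add _ _ hs ht => rw [map_add]; exact (hs f).add (ht f)
  | tr h _ hs =>
    obtain ⟨W, a, b, hab⟩ := FinGSet.exists_isPullback f h
    rw [(box M N).res_tr _ _ _ _ hab]
    exact (hs b).tr a

/-- This induction principle reduces identities between additive maps on a box product to symbols
and compatibility with transfers. -/
theorem all (X : FinGSet G) (s : (box M N).obj X) : BoxGenerated M N X s := by
  revert s
  refine Quotient.ind fun t => ?_
  induction t with
  | tmul m n => exact .tmul m n
  | @zero X =>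
    have := BoxGenerated.tmul (M := M) (N := N) (0 : M.obj X) 0
    rwa [map_zero] at this
  | add _ _ ha hb => exact ha.add hb
  | neg _ ha => exact ha.neg
  | smul c _ ha => exact ha.smul c
  | resOp f _ ha => exact ha.res f
  | trOp f _ ha => exact ha.tr f

end BoxGenerated

/-! ### The `R`-module structure on `R ⊠_k A`. -/

section ExtendScalars

variable (f : k ⟶ R) (A : TModule k)

/-- The `k`-module `R ⊠_k A`. -/
abbrev extendBox : TModule k := box (R.toModule.restrictScalars f) A

/-- The symbol `r ⊗ a` in `(R ⊠_k A)(X)`. -/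
def extendTmul {X : FinGSet G} (r : R.obj X) (a : A.obj X) : (extendBox f A).obj X :=
  (boxPairing (R.toModule.restrictScalars f) A).app X r a

variable {A} in
theorem res_extendTmul {X Y : FinGSet G} (h : X →[G] Y) (r : R.obj Y) (a : A.obj Y) :
    (extendBox f A).res h (extendTmul f A r a) = extendTmul f A (R.res h r) (A.res h a) :=
  ((boxPairing (R.toModule.restrictScalars f) A).app_res h r a).symm

variable {A} in
theorem tr_extendTmul_res {X Y : FinGSet G} (h : X →[G] Y) (r : R.obj X) (a : A.obj Y) :
    (extendBox f A).tr h (extendTmul f A r (A.res h a)) = extendTmul f A (R.tr h r) a :=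
  ((boxPairing (R.toModule.restrictScalars f) A).app_tr_left h r a).symm

variable {A} in
theorem tr_extendTmul_res_left {X Y : FinGSet G} (h : X →[G] Y) (r : R.obj Y) (a : A.obj X) :
    (extendBox f A).tr h (extendTmul f A (R.res h r) a) = extendTmul f A r (A.tr h a) :=
  ((boxPairing (R.toModule.restrictScalars f) A).app_tr_right h r a).symm

variable {A} in
theorem add_extendTmul {X : FinGSet G} (r r' : R.obj X) (a : A.obj X) :
    extendTmul f A (r + r') a = extendTmul f A r a + extendTmul f A r' a :=
  LinearMap.map_add₂ ((boxPairing (R.toModule.restrictScalars f) A).app X) r r' a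

variable {A} in
theorem extendTmul_add {X : FinGSet G} (r : R.obj X) (a a' : A.obj X) :
    extendTmul f A r (a + a') = extendTmul f A r a + extendTmul f A r a' :=
  map_add ((boxPairing (R.toModule.restrictScalars f) A).app X r) a a'

variable {A} in
theorem map_mul_extendTmul {X : FinGSet G} (c : k.obj X) (r : R.obj X) (a : A.obj X) :
    extendTmul f A (f.app X c * r) a = c • extendTmul f A r a :=
  LinearMap.map_smul₂ ((boxPairing (R.toModule.restrictScalars f) A).app X) c r a

variable {A} in
theorem extendTmul_smul {X : FinGSet G} (c : k.obj X) (r : R.obj X) (a : A.obj X) :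
    extendTmul f A r (c • a) = c • extendTmul f A r a :=
  map_smul ((boxPairing (R.toModule.restrictScalars f) A).app X r) c a

variable {A} in
theorem extendBox_induction {p : ∀ X : FinGSet G, (extendBox f A).obj X → Prop}
    (tmul : ∀ (X : FinGSet G) (r : R.obj X) (a : A.obj X), p X (extendTmul f A r a))
    (add : ∀ (X : FinGSet G) (s t : (extendBox f A).obj X), p X s → p X t → p X (s + t))
    (tr : ∀ (X Y : FinGSet G) (h : X →[G] Y) (s : (extendBox f A).obj X), p X s →
      p Y ((extendBox f A).tr h s)) (X : FinGSet G) (t : (extendBox f A).obj X) : p X t := by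
  induction BoxGenerated.all X t with
  | tmul r a => exact tmul _ r a
  | add _ _ hs ht => exact add _ _ _ hs ht
  | tr h _ hs => exact tr _ _ h _ hs

/-- For `r` in `R(V)`, the pairing `(m, a) ↦ (m ⊠ r) ⊗ a` of `R` and `A`
with values in `Y ↦ (R ⊠_k A)(Y × V)`. -/
noncomputable def extendPairing {V : FinGSet G} (r : R.obj V) :
    Pairing (R.toModule.restrictScalars f) A ((extendBox f A).shift V) where
  app Y := LinearMap.mk₂ (k.obj Y)
    (fun (m : R.obj Y) (a : A.obj Y) => (extendTmul f A (R.res (FinGSet.fst Y V) m *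
      R.res (FinGSet.snd Y V) r) (A.res (FinGSet.fst Y V) a) : ((extendBox f A).shift V).obj Y))
    (fun (m m' : R.obj Y) a => by
      refine Eq.trans ?_ (add_extendTmul f _ _ _)
      rw [← add_mul, ← map_add]
      rfl)
    (fun c (m : R.obj Y) a => by
      refine Eq.trans ?_ (map_mul_extendTmul f (k.res (FinGSet.fst Y V) c) _ _)
      rw [f.app_res, ← mul_assoc, ← map_mul]
      rfl)
    (fun m a a' => by
      refine Eq.trans ?_ (extendTmul_add f _ _ _)
      rw [map_add])
    (fun c m a => by
      refine Eq.trans ?_ (extendTmul_smul f (k.res (FinGSet.fst Y V) c) _ _)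
      rw [A.res_smul])
  app_res {X Y} h (m : R.obj Y) (a : A.obj Y) := by
    refine Eq.trans ?_ (res_extendTmul f (FinGSet.mapLeft h V) _ _).symm
    change extendTmul f A (R.res (FinGSet.fst X V) (R.res h m) * R.res (FinGSet.snd X V) r)
      (A.res (FinGSet.fst X V) (A.res h a)) = _
    rw [map_mul, ← R.res_comp, ← R.res_comp, ← R.res_comp, ← A.res_comp, ← A.res_comp,
      FinGSet.fst_comp_mapLeft, FinGSet.snd_comp_mapLeft]
  app_tr_left {X Y} h (m : R.obj X) (a : A.obj Y) := by
    change extendTmul f A (R.res (FinGSet.fst Y V) (R.tr h m) * R.res (FinGSet.snd Y V) r)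
        (A.res (FinGSet.fst Y V) a) =
      (extendBox f A).tr (FinGSet.mapLeft h V) (extendTmul f A (R.res (FinGSet.fst X V) m *
        R.res (FinGSet.snd X V) r) (A.res (FinGSet.fst X V) (A.res h a)))
    -- Both `h.comp (fst X V)` and `snd X V` factor through `mapLeft h V`. The factors coming from
    -- `a` and `r` are thus restrictions along the map of the transfer, and the projection formulas
    -- take them out.
    rw [← A.res_comp, ← FinGSet.fst_comp_mapLeft, A.res_comp, tr_extendTmul_res,
      ← FinGSet.snd_comp_mapLeft h, R.res_comp,
      mul_comm (R.res (FinGSet.fst X V) m), R.tr_res_mul, mul_comm,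
      R.res_tr _ _ _ _ (FinGSet.isPullback_mapLeft_fst h V)]
  app_tr_right {X Y} h (m : R.obj Y) (a : A.obj X) := by
    change extendTmul f A (R.res (FinGSet.fst Y V) m * R.res (FinGSet.snd Y V) r)
        (A.res (FinGSet.fst Y V) (A.tr h a)) =
      (extendBox f A).tr (FinGSet.mapLeft h V) (extendTmul f A (R.res (FinGSet.fst X V)
        (R.res h m) * R.res (FinGSet.snd X V) r) (A.res (FinGSet.fst X V) a))
    rw [← R.res_comp, ← FinGSet.fst_comp_mapLeft, ← FinGSet.snd_comp_mapLeft h, R.res_comp,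
      R.res_comp _ _ r, ← map_mul, tr_extendTmul_res_left,
      A.res_tr _ _ _ _ (FinGSet.isPullback_mapLeft_fst h V)]

/-- Multiplication by `r ∈ R(V)` as a map `(R ⊠_k A)(Y) → (R ⊠_k A)(Y × V)`. -/
noncomputable def extendMulShift {V : FinGSet G} (r : R.obj V) (Y : FinGSet G) :
    (extendBox f A).obj Y →+ (extendBox f A).obj (Y.prod V) :=
  ((boxLift (extendPairing f A r)).app Y).toAddMonoidHom

variable {A}

theorem extendMulShift_tmul {V Y : FinGSet G} (r : R.obj V) (m : R.obj Y) (a : A.obj Y) :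
    extendMulShift f A r Y (extendTmul f A m a) = extendTmul f A (R.res (FinGSet.fst Y V) m *
      R.res (FinGSet.snd Y V) r) (A.res (FinGSet.fst Y V) a) :=
  rfl

theorem extendMulShift_tr {V X Y : FinGSet G} (r : R.obj V) (h : X →[G] Y)
    (t : (extendBox f A).obj X) :
    extendMulShift f A r Y ((extendBox f A).tr h t) =
      (extendBox f A).tr (FinGSet.mapLeft h V) (extendMulShift f A r X t) :=
  (boxLift (extendPairing f A r)).app_tr h t

/-- Naturality of the external product in the level of `r`. The transfer case is base change in the
square with sides `j × id` and `id × h`. -/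
theorem res_extendMulShift {V W : FinGSet G} (h : W →[G] V) (r : R.obj V) (Y : FinGSet G)
    (t : (extendBox f A).obj Y) :
    (extendBox f A).res (FinGSet.mapRight Y h) (extendMulShift f A r Y t) =
      extendMulShift f A (R.res h r) Y t := by
  induction Y, t using extendBox_induction with
  | tmul Y m a =>
    rw [extendMulShift_tmul, extendMulShift_tmul, res_extendTmul, map_mul, ← R.res_comp,
      ← R.res_comp, ← R.res_comp, ← A.res_comp, FinGSet.fst_comp_mapRight,
      FinGSet.snd_comp_mapRight]
  | add Y s t hs ht =>
    rw [map_add, map_add, map_add, hs, ht]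
  | tr X Y j s hs =>
    rw [extendMulShift_tr, extendMulShift_tr, ← hs,
      (extendBox f A).res_tr _ _ _ _ (FinGSet.isPullback_mapLeft_mapRight j h)]

/-- The action of `R(X)` on `(R ⊠_k A)(X)`. -/
noncomputable def extendSMul {X : FinGSet G} (r : R.obj X) :
    (extendBox f A).obj X →+ (extendBox f A).obj X :=
  ((extendBox f A).res (FinGSet.diag X)).comp
    (extendMulShift f A r X)

theorem extendSMul_tmul {X : FinGSet G} (r m : R.obj X) (a : A.obj X) :
    extendSMul f r (extendTmul f A m a) = extendTmul f A (r * m) a := by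
  have h1 : (FinGSet.fst X X).comp (FinGSet.diag X) = MulActionHom.id G := by ext; simp
  have h2 : (FinGSet.snd X X).comp (FinGSet.diag X) = MulActionHom.id G := by ext; simp
  refine (res_extendTmul f (FinGSet.diag X) (R.res (FinGSet.fst X X) m * R.res (FinGSet.snd X X) r)
    (A.res (FinGSet.fst X X) a)).trans ?_
  rw [map_mul, ← R.res_comp, ← R.res_comp, ← A.res_comp, h1, h2, R.res_id, R.res_id, A.res_id,
    mul_comm]

/-- The external product commutes with the transfer, base change along the graph of `h` passes the
diagonal, and naturality turns `r` into its restriction. With `extendSMul_tmul` this determines the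
action on generators, so the module axioms below reduce to ring identities in `R`. -/
theorem extendSMul_tr {X Y : FinGSet G} (h : X →[G] Y) (r : R.obj Y)
    (t : (extendBox f A).obj X) :
    extendSMul f r ((extendBox f A).tr h t) =
      (extendBox f A).tr h (extendSMul f (R.res h r) t) := by
  change (extendBox f A).res (FinGSet.diag Y) (extendMulShift f A r Y _) =
    (extendBox f A).tr h ((extendBox f A).res (FinGSet.diag X) (extendMulShift f A _ X t))
  rw [extendMulShift_tr, ← res_extendMulShift,
    (extendBox f A).res_tr _ _ _ _ (FinGSet.isPullback_graph h), (extendBox f A).res_comp]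

theorem extendSMul_add {X : FinGSet G} (r r' : R.obj X) (t : (extendBox f A).obj X) :
    extendSMul f (r + r') t = extendSMul f r t + extendSMul f r' t := by
  induction X, t using extendBox_induction with
  | tmul X m a => simp only [extendSMul_tmul, add_mul, add_extendTmul]
  | add X s t hs ht => rw [map_add, map_add, map_add, hs, ht, add_add_add_comm]
  | tr X Y h s hs => simp only [extendSMul_tr, map_add, hs]

theorem extendSMul_mul {X : FinGSet G} (r r' : R.obj X) (t : (extendBox f A).obj X) :
    extendSMul f (r * r') t = extendSMul f r (extendSMul f r' t) := by
  induction X, t using extendBox_induction with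
  | tmul X m a => simp only [extendSMul_tmul, mul_assoc]
  | add X s t hs ht => simp only [map_add, hs, ht]
  | tr X Y h s hs => simp only [extendSMul_tr, map_mul, hs]

theorem extendSMul_one {X : FinGSet G} (t : (extendBox f A).obj X) :
    extendSMul f 1 t = t := by
  induction X, t using extendBox_induction with
  | tmul X m a => simp only [extendSMul_tmul, one_mul]
  | add X s t hs ht => simp only [map_add, hs, ht]
  | tr X Y h s hs => simp only [extendSMul_tr, map_one, hs]

theorem extendSMul_map {X : FinGSet G} (c : k.obj X) (t : (extendBox f A).obj X) :
    extendSMul f (f.app X c) t = c • t := by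
  induction X, t using extendBox_induction with
  | tmul X m a => rw [extendSMul_tmul, map_mul_extendTmul]
  | add X s t hs ht => rw [map_add, hs, ht, smul_add]
  | tr X Y h s hs => rw [extendSMul_tr, ← f.app_res, hs, (extendBox f A).tr_res_smul]

/-- For a transfer, both sides become transfers along the pulled back map. The scalars match because
the square commutes. The induction must allow `h` to vary, since it is replaced by its base change.
-/
theorem res_extendSMul {X Y : FinGSet G} (h : X →[G] Y) (r : R.obj Y)
    (t : (extendBox f A).obj Y) :
    (extendBox f A).res h (extendSMul f r t) =
      extendSMul f (R.res h r) ((extendBox f A).res h t) := by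
  induction Y, t using extendBox_induction generalizing X with
  | tmul Y m a => simp only [extendSMul_tmul, res_extendTmul, map_mul]
  | add Y s t hs ht => simp only [map_add, hs, ht]
  | tr Z Y j s hs =>
    obtain ⟨W, a, b, hab⟩ := FinGSet.exists_isPullback h j
    have : h.comp a = j.comp b := by ext w; exact hab.comm w
    rw [extendSMul_tr, (extendBox f A).res_tr _ _ _ _ hab, (extendBox f A).res_tr _ _ _ _ hab, hs,
      extendSMul_tr, ← R.res_comp, ← R.res_comp, this]

/-- On a transfer along `j`, the pullback square of `h` and `j` is used in both directions: once to
restrict the transferred element along `h`, and once, transposed, to restrict `R.tr h r` along `j`.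
-/
theorem tr_extendSMul_res {X Y : FinGSet G} (h : X →[G] Y) (r : R.obj X)
    (t : (extendBox f A).obj Y) :
    (extendBox f A).tr h (extendSMul f r ((extendBox f A).res h t)) =
      extendSMul f (R.tr h r) t := by
  induction Y, t using extendBox_induction generalizing X with
  | tmul Y m a =>
    rw [res_extendTmul, extendSMul_tmul, extendSMul_tmul, tr_extendTmul_res, mul_comm,
      R.tr_res_mul, mul_comm]
  | add Y s t hs ht => simp only [map_add, hs, ht]
  | tr Z Y j s hs =>
    obtain ⟨W, a, b, hab⟩ := FinGSet.exists_isPullback h j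
    have : h.comp a = j.comp b := by ext w; exact hab.comm w
    have hba : FinGSet.IsPullback b a j h :=
      ⟨fun w => (hab.comm w).symm, fun x y hxy => by
        obtain ⟨w, hw, hw'⟩ := hab.existsUnique y x hxy.symm
        exact ⟨w, hw.symm, fun v hv => hw' v hv.symm⟩⟩
    rw [extendSMul_tr, (extendBox f A).res_tr _ _ _ _ hab, extendSMul_tr,
      ← (extendBox f A).tr_comp, this, (extendBox f A).tr_comp, hs,
      R.res_tr _ _ _ _ hba]

variable (A)

/-- The `R`-module `R ⊠_k A`. -/
noncomputable def extendScalars : TModule R where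
  obj := (extendBox f A).obj
  instModule X :=
    letI : SMul (R.obj X) ((extendBox f A).obj X) := ⟨fun r => extendSMul f r⟩
    Module.ofMinimalAxioms (fun r => map_add (extendSMul f r)) (extendSMul_add f)
      (extendSMul_mul f) (extendSMul_one f)
  res := (extendBox f A).res
  tr := (extendBox f A).tr
  res_id := (extendBox f A).res_id
  tr_id := (extendBox f A).tr_id
  res_comp := (extendBox f A).res_comp
  tr_comp := (extendBox f A).tr_comp
  bijective := (extendBox f A).bijective
  res_tr := (extendBox f A).res_tr
  res_smul := res_extendSMul f
  tr_res_smul h r t := (extendSMul_tr f h r t).symm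
  tr_smul_res := tr_extendSMul_res f

variable {A} {B C : TModule k}

theorem boxMap_extendTmul (φ : Hom A B) {X : FinGSet G} (r : R.obj X) (a : A.obj X) :
    (boxMap (R.toModule.restrictScalars f) φ).app X (extendTmul f A r a) =
      extendTmul f B r (φ.app X a) :=
  rfl

theorem boxMap_extendSMul (φ : Hom A B) {X : FinGSet G} (r : R.obj X)
    (t : (extendBox f A).obj X) :
    (boxMap (R.toModule.restrictScalars f) φ).app X (extendSMul f r t) =
      extendSMul f r ((boxMap (R.toModule.restrictScalars f) φ).app X t) := by
  induction X, t using extendBox_induction with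
  | tmul X m a => simp only [extendSMul_tmul, boxMap_extendTmul]
  | add X s t hs ht => simp only [map_add, hs, ht]
  | tr X Y h s hs => simp only [extendSMul_tr, Hom.app_tr, hs]

/-- The functor `R ⊠_k -` from `k`-modules to `R`-modules on morphisms. -/
noncomputable def extendMap (φ : Hom A B) : Hom (extendScalars f A) (extendScalars f B) where
  app X :=
    { toFun := (boxMap (R.toModule.restrictScalars f) φ).app X
      map_add' := map_add ((boxMap (R.toModule.restrictScalars f) φ).app X)
      map_smul' := boxMap_extendSMul f φ }
  app_res := (boxMap (R.toModule.restrictScalars f) φ).app_res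
  app_tr := (boxMap (R.toModule.restrictScalars f) φ).app_tr

end ExtendScalars

/-! ### Comparison of `S ⊠_R (R ⊠_k A)` with `S ⊠_k A`. -/

section Comp

variable (f : k ⟶ R) (g : R ⟶ S) (A : TModule k)

/-- The morphism `R ⊠_k A → S ⊠_k A`. -/
noncomputable def extendChange : Hom (extendBox f A) (extendBox (f ≫ g) A) :=
  boxLift
    { app := fun X => LinearMap.mk₂ (k.obj X)
        (fun (r : R.obj X) (a : A.obj X) => extendTmul (f ≫ g) A (g.app X r) a)
        (fun (r r' : R.obj X) a => by
          rw [← add_extendTmul, ← map_add]; rfl)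
        (fun c (r : R.obj X) a => by
          rw [← map_mul_extendTmul, TambaraFunctor.hom_comp_app, ← map_mul]; rfl)
        (fun r a a' => extendTmul_add _ _ _ _)
        (fun c r a => extendTmul_smul _ _ _ _)
      app_res := fun {X Y} h (r : R.obj Y) a => by
        refine Eq.trans ?_ (res_extendTmul (f ≫ g) h _ _).symm
        exact congrArg (extendTmul (f ≫ g) A · (A.res h a)) (g.app_res h r)
      app_tr_left := fun {X Y} h (r : R.obj X) a => by
        refine Eq.trans ?_ (tr_extendTmul_res (f ≫ g) h _ _).symm
        exact congrArg (extendTmul (f ≫ g) A · a) (g.app_tr h r)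
      app_tr_right := fun {X Y} h (r : R.obj Y) a => by
        refine Eq.trans (tr_extendTmul_res_left (f ≫ g) h _ _).symm ?_
        exact congrArg (fun s => (extendBox (f ≫ g) A).tr h (extendTmul (f ≫ g) A s a))
          (g.app_res h r).symm }

variable {A}

theorem extendChange_tmul {X : FinGSet G} (r : R.obj X) (a : A.obj X) :
    (extendChange f g A).app X (extendTmul f A r a) = extendTmul (f ≫ g) A (g.app X r) a :=
  rfl

/-- Semilinearity over `g`, which makes `(s, t) ↦ s • t` a pairing over `R` in `extendTwiceTo`. -/
theorem extendChange_extendSMul {X : FinGSet G} (r : R.obj X) (t : (extendBox f A).obj X) :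
    (extendChange f g A).app X (extendSMul f r t) =
      extendSMul (f ≫ g) (g.app X r) ((extendChange f g A).app X t) := by
  induction X, t using extendBox_induction with
  | tmul X m a => simp only [extendSMul_tmul, extendChange_tmul, map_mul]
  | add X s t hs ht => simp only [map_add, hs, ht]
  | tr X Y h s hs => simp only [extendSMul_tr, Hom.app_tr, hs, g.app_res]

theorem extendChange_boxMap {B : TModule k} (φ : Hom A B) {X : FinGSet G}
    (t : (extendBox f A).obj X) :
    (extendChange f g B).app X ((boxMap (R.toModule.restrictScalars f) φ).app X t) =
      (boxMap (S.toModule.restrictScalars (f ≫ g)) φ).app X ((extendChange f g A).app X t) := by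
  induction X, t using extendBox_induction with
  | tmul X m a => simp only [boxMap_extendTmul, extendChange_tmul]
  | add X s t hs ht => simp only [map_add, hs, ht]
  | tr X Y h s hs => simp only [Hom.app_tr, hs]

variable (A)

/-- The `R`-module `S ⊠_R (R ⊠_k A)`. -/
noncomputable abbrev extendTwice : TModule R := extendBox g (extendScalars f A)

/-- The morphism `S ⊠_R (R ⊠_k A) → S ⊠_k A`. -/
noncomputable def extendTwiceTo :
    Hom (extendTwice f g A) ((extendScalars (f ≫ g) A).restrictScalars g) :=
  boxLift
    { app := fun X => LinearMap.mk₂ (R.obj X)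
        (fun (s : S.obj X) (t : (extendBox f A).obj X) =>
          (extendSMul (f ≫ g) s ((extendChange f g A).app X t) :
            ((extendScalars (f ≫ g) A).restrictScalars g).obj X))
        (fun (s s' : S.obj X) t => extendSMul_add (f ≫ g) s s' _)
        (fun (r : R.obj X) (s : S.obj X) t => extendSMul_mul (f ≫ g) (g.app X r) s _)
        (fun (s : S.obj X) (t t' : (extendBox f A).obj X) =>
          (congrArg (extendSMul (f ≫ g) s) (map_add ((extendChange f g A).app X) t t')).trans
            (map_add (extendSMul (f ≫ g) s) _ _))
        (fun (r : R.obj X) (s : S.obj X) (t : (extendBox f A).obj X) => by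
          refine (congrArg (extendSMul (f ≫ g) s) (extendChange_extendSMul f g r t)).trans ?_
          rw [← extendSMul_mul, mul_comm, extendSMul_mul]
          rfl)
      app_res := fun h (s : S.obj _) (t : (extendBox f A).obj _) => by
        refine (congrArg (extendSMul (f ≫ g) (S.res h s))
          ((extendChange f g A).app_res h t)).trans ?_
        exact (res_extendSMul (f ≫ g) h s _).symm
      app_tr_left := fun h (s : S.obj _) (t : (extendBox f A).obj _) => by
        refine Eq.trans (tr_extendSMul_res (f ≫ g) h s _).symm ?_
        exact congrArg (fun t => (extendBox (f ≫ g) A).tr h (extendSMul (f ≫ g) s t))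
          ((extendChange f g A).app_res h t).symm
      app_tr_right := fun h (s : S.obj _) (t : (extendBox f A).obj _) => by
        refine (congrArg (extendSMul (f ≫ g) s) ((extendChange f g A).app_tr h t)).trans ?_
        exact extendSMul_tr (f ≫ g) h s _ }

theorem extendTwiceTo_tmul {X : FinGSet G} (s : S.obj X) (t : (extendBox f A).obj X) :
    (extendTwiceTo f g A).app X (extendTmul g (extendScalars f A) s t) =
      extendSMul (f ≫ g) s ((extendChange f g A).app X t) :=
  rfl

/-- The morphism `S ⊠_k A → S ⊠_R (R ⊠_k A)`. -/
noncomputable def toExtendTwice :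
    Hom (extendBox (f ≫ g) A) ((extendTwice f g A).restrictScalars f) :=
  boxLift
    { app := fun X => LinearMap.mk₂ (k.obj X)
        (fun (s : S.obj X) (a : A.obj X) =>
          (extendTmul g (extendScalars f A) s (extendTmul f A 1 a) :
            ((extendTwice f g A).restrictScalars f).obj X))
        (fun (s s' : S.obj X) a => add_extendTmul g s s' _)
        (fun (c : k.obj X) (s : S.obj X) a => map_mul_extendTmul g (f.app X c) s _)
        (fun (s : S.obj X) (a a' : A.obj X) =>
          (congrArg (extendTmul g (extendScalars f A) s) (extendTmul_add f 1 a a')).trans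
            (extendTmul_add g s _ _))
        (fun (c : k.obj X) (s : S.obj X) (a : A.obj X) => by
          refine (congrArg (extendTmul g (extendScalars f A) s) ((extendTmul_smul f c 1 a).trans
            (extendSMul_map f c _).symm)).trans ?_
          exact extendTmul_smul g (f.app X c) s _)
      app_res := fun {X Y} h (s : S.obj _) (a : A.obj _) => by
        refine Eq.trans ?_ (res_extendTmul g h s _).symm
        refine congrArg (extendTmul g (extendScalars f A) (S.res h s)) ?_
        refine Eq.trans ?_ (res_extendTmul f h 1 a).symm
        rw [map_one]
      app_tr_left := fun {X Y} h (s : S.obj _) (a : A.obj _) => by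
        refine Eq.trans (tr_extendTmul_res g h s _).symm ?_
        refine congrArg (fun t => (extendTwice f g A).tr h
          (extendTmul g (extendScalars f A) s t)) ?_
        refine (res_extendTmul f h 1 a).trans ?_
        rw [map_one]
      app_tr_right := fun {X Y} h (s : S.obj _) (a : A.obj _) => by
        refine Eq.trans ?_ (tr_extendTmul_res_left g h s _).symm
        refine congrArg (extendTmul g (extendScalars f A) s) ?_
        refine (tr_extendTmul_res_left f h 1 a).symm.trans ?_
        rw [map_one]
        rfl }

theorem toExtendTwice_tmul {X : FinGSet G} (s : S.obj X) (a : A.obj X) :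
    (toExtendTwice f g A).app X (extendTmul (f ≫ g) A s a) =
      extendTmul g (extendScalars f A) s (extendTmul f A 1 a) :=
  rfl

/-- On symbols, `s ⊗ a` goes to `s ⊗ (1 ⊗ a)` and then to `s • (1 ⊗ a) = s ⊗ a`. Being a retract
suffices for exactness, so the other composite plays no role. -/
theorem extendTwiceTo_toExtendTwice {X : FinGSet G} (t : (extendBox (f ≫ g) A).obj X) :
    (extendTwiceTo f g A).app X ((toExtendTwice f g A).app X t) = t := by
  induction X, t using extendBox_induction with
  | tmul X s a =>
    rw [toExtendTwice_tmul, extendTwiceTo_tmul, extendChange_tmul, extendSMul_tmul, map_one,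
      mul_one]
  | add X s t hs ht =>
    rw [map_add]
    exact (map_add ((extendTwiceTo f g A).app X) _ _).trans (congrArg₂ (· + ·) hs ht)
  | tr X Y h s hs =>
    rw [Hom.app_tr]
    exact ((extendTwiceTo f g A).app_tr h _).trans
      (congrArg ((extendBox (f ≫ g) A).tr h) hs)

variable {A} {B C : TModule k}

theorem toExtendTwice_boxMap (φ : Hom A B) {X : FinGSet G} (t : (extendBox (f ≫ g) A).obj X) :
    (toExtendTwice f g B).app X ((boxMap (S.toModule.restrictScalars (f ≫ g)) φ).app X t) =
      (boxMap (S.toModule.restrictScalars g) (extendMap f φ)).app X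
        ((toExtendTwice f g A).app X t) := by
  induction X, t using extendBox_induction with
  | tmul X s a => rfl
  | add X s t hs ht =>
    rw [map_add, map_add, map_add]
    exact (congrArg₂ (· + ·) hs ht).trans (map_add ((boxMap _ (extendMap f φ)).app X) _ _).symm
  | tr X Y h s hs =>
    rw [Hom.app_tr, Hom.app_tr, Hom.app_tr]
    exact (congrArg ((extendTwice f g B).tr h) hs).trans
      ((boxMap _ (extendMap f φ)).app_tr h _).symm

theorem extendTwiceTo_boxMap (φ : Hom A B) {X : FinGSet G} (t : (extendTwice f g A).obj X) :
    (extendTwiceTo f g B).app X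
        ((boxMap (S.toModule.restrictScalars g) (extendMap f φ)).app X t) =
      (boxMap (S.toModule.restrictScalars (f ≫ g)) φ).app X ((extendTwiceTo f g A).app X t) := by
  induction X, t using extendBox_induction with
  | tmul X s t =>
    refine Eq.trans ?_ (boxMap_extendSMul (f ≫ g) φ s ((extendChange f g A).app X t)).symm
    exact congrArg (extendSMul (f ≫ g) s) (extendChange_boxMap f g φ t)
  | add X s t hs ht =>
    rw [map_add, map_add, map_add, hs, ht]
    exact (map_add ((boxMap (S.toModule.restrictScalars (f ≫ g)) φ).app X) _ _).symm
  | tr X Y h s hs =>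
    rw [Hom.app_tr, Hom.app_tr, Hom.app_tr, hs]
    exact ((boxMap (S.toModule.restrictScalars (f ≫ g)) φ).app_tr h _).symm

end Comp

end TModule

/-! ### Transitivity of flatness. -/

namespace TambaraFunctor

variable {G : Type u} [Group G] {k R S : TambaraFunctor G}

theorem Flat.comp {f : k ⟶ R} {g : R ⟶ S} (hg : Flat g) (hf : Flat f) : Flat (f ≫ g) := by
  intro A B C φ ψ h X
  -- `extendMap` has the same underlying functions as `boxMap`, so exactness over `k` is already
  -- exactness of the sequence of `R`-modules.
  have key := hg _ _ _ (TModule.extendMap f φ) (TModule.extendMap f ψ) (hf A B C φ ψ h) X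
  intro t
  constructor
  · intro ht
    have h1 := TModule.toExtendTwice_boxMap f g ψ t
    rw [ht, map_zero] at h1
    -- A cycle is carried into `S ⊠_R (R ⊠_k B)`, found to be a boundary there, and the preimage is
    -- carried back by the retraction.
    obtain ⟨u, hu⟩ := (key _).1 h1.symm
    refine ⟨(TModule.extendTwiceTo f g A).app X u, ?_⟩
    rw [← TModule.extendTwiceTo_boxMap, hu, TModule.extendTwiceTo_toExtendTwice]
  · rintro ⟨u, rfl⟩
    rw [← TModule.extendTwiceTo_toExtendTwice f g C (TModule.Hom.app _ X _),
      TModule.toExtendTwice_boxMap, TModule.toExtendTwice_boxMap]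
    exact (congrArg ((TModule.extendTwiceTo f g C).app X) ((key _).2 ⟨_, rfl⟩)).trans
      (map_zero ((TModule.extendTwiceTo f g C).app X))

end TambaraFunctor

/-! ## Finite presentations -/

namespace TambaraFunctor

variable {G : Type u} [Group G]

/-- Substitution of formal expressions for the generators. -/
def Term.subst {Γ Δ : FinGSet G → Type u} (σ : ∀ X : FinGSet G, Γ X → Term Δ X) :
    ∀ {X : FinGSet G}, Term Γ X → Term Δ X
  | X, of a => σ X a
  | _, zero => zero
  | _, one => one
  | _, add a b => add (subst σ a) (subst σ b)
  | _, mul a b => mul (subst σ a) (subst σ b)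
  | _, neg a => neg (subst σ a)
  | _, resOp f a => resOp f (subst σ a)
  | _, trOp f a => trOp f (subst σ a)
  | _, nmOp f a => nmOp f (subst σ a)

theorem Term.eval_subst {Γ Δ : FinGSet G → Type u} (σ : ∀ X : FinGSet G, Γ X → Term Δ X)
    {T : TambaraFunctor G} {v : ∀ X : FinGSet G, Δ X → T.obj X}
    {w : ∀ X : FinGSet G, Γ X → T.obj X} (h : ∀ X a, (σ X a).eval T v = w X a) {X : FinGSet G}
    (p : Term Γ X) : (p.subst σ).eval T v = p.eval T w := by
  induction p with
  | of a => exact h _ a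
  | zero => rfl
  | one => rfl
  | add _ _ ha hb => simp only [subst, eval, ha, hb]
  | mul _ _ ha hb => simp only [subst, eval, ha, hb]
  | neg _ ha => simp only [subst, eval, ha]
  | resOp _ _ ha => simp only [subst, eval, ha]
  | trOp _ _ ha => simp only [subst, eval, ha]
  | nmOp _ _ ha => simp only [subst, eval, ha]

theorem Term.map_eval {Γ : FinGSet G → Type u} {T U : TambaraFunctor G} (φ : T ⟶ U)
    {v : ∀ X : FinGSet G, Γ X → T.obj X} {w : ∀ X : FinGSet G, Γ X → U.obj X}
    (h : ∀ X a, φ.app X (v X a) = w X a) {X : FinGSet G} (p : Term Γ X) :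
    φ.app X (p.eval T v) = p.eval U w := by
  induction p with
  | of a => exact h _ a
  | zero => exact map_zero _
  | one => exact map_one _
  | add _ _ ha hb => simp only [eval, map_add, ha, hb]
  | mul _ _ ha hb => simp only [eval, map_mul, ha, hb]
  | neg _ ha => simp only [eval, map_neg, ha]
  | resOp _ _ ha => simp only [eval, φ.app_res, ha]
  | trOp _ _ ha => simp only [eval, φ.app_tr, ha]
  | nmOp _ _ ha => simp only [eval, φ.app_nm, ha]

/-- This exhibits a class as an evaluation, so that `Term.map_eval` computes its image under any
morphism. -/
theorem Term.eval_mk {Γ : FinGSet G → Type u}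
    (E : ∀ X : FinGSet G, Term Γ X → Term Γ X → Prop) {X : FinGSet G} (p : Term Γ X) :
    p.eval (presented E) (fun X a => Quotient.mk (relSetoid E X) (Term.of a)) =
      Quotient.mk (relSetoid E X) p := by
  induction p with
  | of a => rfl
  | zero => rfl
  | one => rfl
  | add _ _ ha hb => simp only [eval, ha, hb]; rfl
  | mul _ _ ha hb => simp only [eval, ha, hb]; rfl
  | neg _ ha => simp only [eval, ha]; rfl
  | resOp _ _ ha => simp only [eval, ha]; rfl
  | trOp _ _ ha => simp only [eval, ha]; rfl
  | nmOp _ _ ha => simp only [eval, ha]; rfl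

/-- Constants of `k` and a variable in level `L i` for each `i`. -/
inductive AlgGen (k : TambaraFunctor G) {ι : Type} (L : ι → FinGSet G) : FinGSet G → Type u
  | const {X : FinGSet G} (c : k.obj X) : AlgGen k L X
  | var (i : ι) : AlgGen k L (L i)

/-! ### Presentations with arbitrary index types, and their composition. -/

section Presentation

variable {k R S T : TambaraFunctor G} {ι κ : Type}

/-- The values of generators in a `k`-algebra, for given values of the variables. -/
def algVal {L : ι → FinGSet G} (h : k ⟶ T) (t : ∀ i, T.obj (L i)) :
    ∀ X : FinGSet G, AlgGen k L X → T.obj X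
  | X, .const c => h.app X c
  | _, .var i => t i

theorem map_algVal {L : ι → FinGSet G} {h : k ⟶ R} {x : ∀ i, R.obj (L i)} {φ : R ⟶ T}
    {h' : k ⟶ T} {t : ∀ i, T.obj (L i)} (w : h ≫ φ = h') (hx : ∀ i, φ.app _ (x i) = t i)
    (X : FinGSet G) (a : AlgGen k L X) : φ.app X (algVal h x X a) = algVal h' t X a := by
  cases a with
  | const c => exact RingHom.congr_fun (congrFun (congrArg Hom.app w) X) c
  | var i => exact hx i

/-- `R` is presented as a `k`-algebra by the generators `x i` and the relations `p j = q j`. -/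
structure IsPresentation (f : k ⟶ R) (L : ι → FinGSet G) (K : κ → FinGSet G)
    (x : ∀ i, R.obj (L i)) (p q : ∀ j, Term (AlgGen k L) (K j)) : Prop where
  relation : ∀ j, (p j).eval R (algVal f x) = (q j).eval R (algVal f x)
  existsUnique : ∀ (T : TambaraFunctor G) (h : k ⟶ T) (t : ∀ i, T.obj (L i)),
    (∀ j, (p j).eval T (algVal h t) = (q j).eval T (algVal h t)) →
    ∃! φ : R ⟶ T, f ≫ φ = h ∧ ∀ i, φ.app _ (x i) = t i

/-- The relations of the algebra with given presentation. -/
inductive PresRel (k : TambaraFunctor G) {L : ι → FinGSet G} {K : κ → FinGSet G}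
    (p q : ∀ j, Term (AlgGen k L) (K j)) :
    ∀ X : FinGSet G, Term (AlgGen k L) X → Term (AlgGen k L) X → Prop
  | hom {X : FinGSet G} {a b : Term (AlgGen k L) X} :
      HomRel k (fun _ c => AlgGen.const c) X a b → PresRel k p q X a b
  | rel (j : κ) : PresRel k p q (K j) (p j) (q j)

/-- The universal property maps `R` to the formally presented algebra, which maps back by
evaluation. The composite is the identity by uniqueness, so any representative of the image of `r`
is an expression with value `r`. -/
theorem IsPresentation.exists_eval_eq {f : k ⟶ R} {L : ι → FinGSet G} {K : κ → FinGSet G}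
    {x : ∀ i, R.obj (L i)} {p q : ∀ j, Term (AlgGen k L) (K j)} (H : IsPresentation f L K x p q)
    {X : FinGSet G} (r : R.obj X) : ∃ s : Term (AlgGen k L) X, s.eval R (algVal f x) = r := by
  let h : k ⟶ presented (PresRel k p q) :=
    homOfRel k (fun _ c => AlgGen.const c) _ fun _ _ _ h => PresRel.hom h
  let t : ∀ i, (presented (PresRel k p q)).obj (L i) := fun i =>
    Quotient.mk (relSetoid (PresRel k p q) (L i)) (Term.of (AlgGen.var i))
  have ht : algVal h t = fun X a => Quotient.mk (relSetoid (PresRel k p q) X) (Term.of a) := by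
    funext X a; cases a <;> rfl
  obtain ⟨φ, ⟨hφ, hφx⟩, -⟩ := H.existsUnique _ h t fun j => by
    rw [ht, Term.eval_mk, Term.eval_mk]
    exact Quotient.sound (Rel.of (PresRel.rel j))
  let ψ : presented (PresRel k p q) ⟶ R := presentedLift R (algVal f x) (by
    intro X a b hab
    cases hab with
    | hom hab => exact HomRel.eval_eq (algVal f x) f (fun _ _ => rfl) hab
    | rel j => exact H.relation j)
  obtain ⟨_, -, hu⟩ := H.existsUnique R f x H.relation
  have : φ ≫ ψ = 𝟙 R := (hu (φ ≫ ψ) ⟨by rw [← Category.assoc, hφ]; rfl, fun i => by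
    rw [hom_comp_app, hφx]; rfl⟩).trans (hu (𝟙 R) ⟨Category.comp_id f, fun _ => rfl⟩).symm
  obtain ⟨s, hs⟩ := Quotient.exists_rep (φ.app X r)
  refine ⟨s, ?_⟩
  have h1 : ψ.app X (φ.app X r) = r := RingHom.congr_fun (congrFun (congrArg Hom.app this) X) r
  rw [← h1, ← hs]
  rfl

/-- The inclusion of the first part of the generators. -/
def algGenInl {ι' : Type} (k : TambaraFunctor G) (L : ι → FinGSet G) (L' : ι' → FinGSet G) :
    ∀ X : FinGSet G, AlgGen k L X → Term (AlgGen k (Sum.elim L L')) X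
  | _, .const c => Term.of (AlgGen.const c)
  | _, .var i => Term.of (AlgGen.var (L := Sum.elim L L') (Sum.inl i))

theorem eval_subst_algGenInl {ι' : Type} {L : ι → FinGSet G} {L' : ι' → FinGSet G} (h : k ⟶ T)
    (t : ∀ i, T.obj (Sum.elim L L' i)) {X : FinGSet G} (p : Term (AlgGen k L) X) :
    (p.subst (algGenInl k L L')).eval T (algVal h t) =
      p.eval T (algVal h fun i => t (Sum.inl i)) :=
  Term.eval_subst _ (fun X a => by cases a <;> rfl) p

/-- Replacement of coefficients in `R` by expressions for them. -/
def algGenLift {ι' : Type} {L : ι → FinGSet G} (L' : ι' → FinGSet G)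
    (s : ∀ X : FinGSet G, R.obj X → Term (AlgGen k L) X) :
    ∀ X : FinGSet G, AlgGen R L' X → Term (AlgGen k (Sum.elim L L')) X
  | X, .const r => (s X r).subst (algGenInl k L L')
  | _, .var i => Term.of (AlgGen.var (L := Sum.elim L L') (Sum.inr i))

/-- The expression chosen for a coefficient `r` has value `r` in `R`, hence value `φ r` in `T`,
because evaluation commutes with `φ`. So the rewriting over `k` evaluates as the original expression
does over `R`, whichever `s` was chosen. -/
theorem eval_subst_algGenLift {ι' : Type} {L : ι → FinGSet G} {L' : ι' → FinGSet G} {f : k ⟶ R}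
    {x : ∀ i, R.obj (L i)} {s : ∀ X : FinGSet G, R.obj X → Term (AlgGen k L) X}
    (hs : ∀ X r, (s X r).eval R (algVal f x) = r) {h : k ⟶ T} {φ : R ⟶ T} (w : f ≫ φ = h)
    {t : ∀ i, T.obj (Sum.elim L L' i)} (hx : ∀ i, φ.app _ (x i) = t (Sum.inl i)) {X : FinGSet G}
    (p : Term (AlgGen R L') X) : (p.subst (algGenLift L' s)).eval T (algVal h t) =
      p.eval T (algVal φ fun i => t (Sum.inr i)) := by
  refine Term.eval_subst _ (fun X a => ?_) p
  cases a with
  | const r =>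
    exact (eval_subst_algGenInl h t (s X r)).trans
      ((Term.map_eval φ (map_algVal w hx) (s X r)).symm.trans (congrArg (φ.app X) (hs X r)))
  | var i => rfl

/-- A morphism out of `S` is built in two stages: the old generators and relations give `φ : R ⟶ T`,
which makes `T` an `R`-algebra, and the new ones then give the morphism from `S`. Sum types as index
types keep the two families apart. -/
theorem IsPresentation.comp {ι' κ' : Type} {f : k ⟶ R} {g : R ⟶ S} {L : ι → FinGSet G}
    {K : κ → FinGSet G} {x : ∀ i, R.obj (L i)} {p q : ∀ j, Term (AlgGen k L) (K j)}
    (H : IsPresentation f L K x p q) {L' : ι' → FinGSet G} {K' : κ' → FinGSet G}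
    {x' : ∀ i, S.obj (L' i)} {p' q' : ∀ j, Term (AlgGen R L') (K' j)}
    (H' : IsPresentation g L' K' x' p' q') {s : ∀ X : FinGSet G, R.obj X → Term (AlgGen k L) X}
    (hs : ∀ X r, (s X r).eval R (algVal f x) = r) :
    IsPresentation (f ≫ g) (Sum.elim L L') (Sum.elim K K')
      (fun i => Sum.rec (motive := fun i => S.obj (Sum.elim L L' i))
        (fun i => g.app _ (x i)) x' i)
      (fun j => Sum.rec (motive := fun j => Term (AlgGen k (Sum.elim L L')) (Sum.elim K K' j))
        (fun j => (p j).subst (algGenInl k L L')) (fun j => (p' j).subst (algGenLift L' s)) j)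
      (fun j => Sum.rec (motive := fun j => Term (AlgGen k (Sum.elim L L')) (Sum.elim K K' j))
        (fun j => (q j).subst (algGenInl k L L')) (fun j => (q' j).subst (algGenLift L' s)) j) where
  relation := by
    rintro (j | j)
    · refine (eval_subst_algGenInl _ _ (p j)).trans (.trans ?_
        (eval_subst_algGenInl _ _ (q j)).symm)
      have := congrArg (g.app _) (H.relation j)
      rwa [Term.map_eval g (map_algVal rfl fun _ => rfl),
        Term.map_eval g (map_algVal rfl fun _ => rfl)] at this
    · refine (eval_subst_algGenLift hs rfl (fun _ => rfl) (p' j)).trans (.trans ?_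
        (eval_subst_algGenLift hs rfl (fun _ => rfl) (q' j)).symm)
      exact H'.relation j
  existsUnique T h t ht := by
    obtain ⟨φ, ⟨hφ, hφx⟩, hφu⟩ := H.existsUnique T h (fun i => t (Sum.inl i)) fun j =>
      (eval_subst_algGenInl h t (p j)).symm.trans
        ((ht (Sum.inl j)).trans (eval_subst_algGenInl h t (q j)))
    obtain ⟨ψ, ⟨hψ, hψx⟩, hψu⟩ := H'.existsUnique T φ (fun i => t (Sum.inr i)) fun j =>
      (eval_subst_algGenLift hs hφ hφx (p' j)).symm.trans
        ((ht (Sum.inr j)).trans (eval_subst_algGenLift hs hφ hφx (q' j)))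
    refine ⟨ψ, ⟨by rw [Category.assoc, hψ, hφ], ?_⟩, ?_⟩
    · rintro (i | i)
      · refine Eq.trans ?_ (hφx i)
        rw [← hψ]
        rfl
      · exact hψx i
    · rintro ψ' ⟨h1, h2⟩
      -- Uniqueness for `R` forces `g ≫ ψ' = φ`, and only then does uniqueness for `S` over `R`
      -- apply.
      refine hψu ψ' ⟨hφu _ ⟨by rw [← h1, Category.assoc], fun i => h2 (Sum.inl i)⟩,
        fun i => h2 (Sum.inr i)⟩

/-- Reindexing of generators. -/
def algGenReindex {ι₁ : Type} (k : TambaraFunctor G) (L : ι → FinGSet G) (e : ι₁ ≃ ι) :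
    ∀ X : FinGSet G, AlgGen k L X → Term (AlgGen k (L ∘ e)) X
  | _, .const c => Term.of (AlgGen.const c)
  | _, .var i => e.piCongrLeft (fun i => Term (AlgGen k (L ∘ e)) (L i))
      (fun i => Term.of (AlgGen.var (L := L ∘ e) i)) i

/-- A variable in level `L i` comes from one in level `L (e (e.symm i))`, which agrees with `L i`
only up to a transport. Writing the index as `e i` makes the transport compute. -/
theorem eval_subst_algGenReindex {ι₁ : Type} {L : ι → FinGSet G} (e : ι₁ ≃ ι) (h : k ⟶ T)
    (t : ∀ i, T.obj (L i)) {X : FinGSet G} (p : Term (AlgGen k L) X) :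
    (p.subst (algGenReindex k L e)).eval T (algVal h fun i => t (e i)) =
      p.eval T (algVal h t) := by
  refine Term.eval_subst _ (fun X a => ?_) p
  cases a with
  | const c => rfl
  | var i =>
    obtain ⟨i, rfl⟩ := e.surjective i
    rw [algGenReindex, Equiv.piCongrLeft_apply_apply]
    rfl

theorem IsPresentation.reindex {ι₁ κ₁ : Type} {f : k ⟶ R} {L : ι → FinGSet G}
    {K : κ → FinGSet G} {x : ∀ i, R.obj (L i)} {p q : ∀ j, Term (AlgGen k L) (K j)}
    (H : IsPresentation f L K x p q) (e : ι₁ ≃ ι) (e' : κ₁ ≃ κ) :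
    IsPresentation f (L ∘ e) (K ∘ e') (fun i => x (e i))
      (fun j => (p (e' j)).subst (algGenReindex k L e))
      (fun j => (q (e' j)).subst (algGenReindex k L e)) where
  relation j := (eval_subst_algGenReindex e f x _).trans
    ((H.relation _).trans (eval_subst_algGenReindex e f x _).symm)
  existsUnique T h t₁ ht := by
    obtain ⟨t, rfl⟩ : ∃ t : ∀ i, T.obj (L i), (fun i => t (e i)) = t₁ :=
      ⟨e.piCongrLeft (fun i => T.obj (L i)) t₁, funext fun i =>
        Equiv.piCongrLeft_apply_apply (fun i => T.obj (L i)) e t₁ i⟩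
    obtain ⟨φ, ⟨h1, h2⟩, hu⟩ := H.existsUnique T h t fun j => by
      obtain ⟨j, rfl⟩ := e'.surjective j
      exact (eval_subst_algGenReindex e h t _).symm.trans
        ((ht j).trans (eval_subst_algGenReindex e h t _))
    exact ⟨φ, ⟨h1, fun i => h2 (e i)⟩, fun ψ hψ => hu ψ ⟨hψ.1, e.surjective.forall.2 hψ.2⟩⟩

/-! ### Presentations versus coequalizers of polynomial algebras. -/

/-- The generators of `poly k L` as expressions in `AlgGen`. -/
def algGenOfPolyGen {n : ℕ} {L : Fin n → FinGSet G} :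
    ∀ X : FinGSet G, PolyGen k L X → Term (AlgGen k L) X
  | _, .const c => Term.of (AlgGen.const c)
  | _, .var i => Term.of (AlgGen.var i)

/-- The inverse of `algGenOfPolyGen`. -/
def polyGenOfAlgGen {n : ℕ} {L : Fin n → FinGSet G} :
    ∀ X : FinGSet G, AlgGen k L X → Term (PolyGen k L) X
  | _, .const c => Term.of (PolyGen.const c)
  | _, .var i => Term.of (PolyGen.var i)

/-- The element of a polynomial algebra given by a formal expression. -/
def polyMk {n : ℕ} {L : Fin n → FinGSet G} {X : FinGSet G} (p : Term (AlgGen k L) X) :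
    (poly k L).right.obj X :=
  Quotient.mk (relSetoid (Γ := PolyGen k L) (HomRel k fun _ c => PolyGen.const c) X)
    (p.subst polyGenOfAlgGen)

theorem map_polyMk {n : ℕ} {L : Fin n → FinGSet G} {X : FinGSet G} (p : Term (AlgGen k L) X)
    {h : k ⟶ T} (χ : poly k L ⟶ Under.mk h) {t : ∀ i, T.obj (L i)}
    (ht : ∀ i, χ.right.app _ (polyVar k L i) = t i) :
    χ.right.app X (polyMk p) = p.eval T (algVal h t) := by
  have hχ (X : FinGSet G) (c : k.obj X) : χ.right.app X ((poly k L).hom.app X c) = h.app X c :=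
    RingHom.congr_fun (congrFun (congrArg Hom.app (Under.w χ)) X) c
  refine (congrArg (χ.right.app X) (Term.eval_mk _ _).symm).trans ?_
  refine (Term.map_eval χ.right (fun _ _ => rfl) _).trans (Term.eval_subst _ (fun X a => ?_) p)
  cases a with
  | const c => exact hχ X c
  | var i => exact ht i

theorem polyMk_surjective {n : ℕ} {L : Fin n → FinGSet G} {X : FinGSet G}
    (a : (poly k L).right.obj X) : ∃ p : Term (AlgGen k L) X, polyMk p = a := by
  obtain ⟨p, rfl⟩ := Quotient.exists_rep a
  refine ⟨p.subst algGenOfPolyGen, congrArg (Quotient.mk _) ?_⟩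
  induction p with
  | of a => cases a <;> rfl
  | zero => rfl
  | one => rfl
  | add _ _ ha hb => simp only [Term.subst, ha, hb]
  | mul _ _ ha hb => simp only [Term.subst, ha, hb]
  | neg _ ha => simp only [Term.subst, ha]
  | resOp _ _ ha => simp only [Term.subst, ha]
  | trOp _ _ ha => simp only [Term.subst, ha]
  | nmOp _ _ ha => simp only [Term.subst, ha]

theorem poly_hom_ext {n : ℕ} {L : Fin n → FinGSet G} {U : Under k} {φ ψ : poly k L ⟶ U}
    (h : ∀ i, φ.right.app _ (polyVar k L i) = ψ.right.app _ (polyVar k L i)) : φ = ψ :=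
  (poly_bijective k L U).1 (funext h)

theorem poly_exists_hom {n : ℕ} {L : Fin n → FinGSet G} (U : Under k)
    (t : ∀ i, U.right.obj (L i)) :
    ∃ φ : poly k L ⟶ U, ∀ i, φ.right.app _ (polyVar k L i) = t i := by
  obtain ⟨φ, hφ⟩ := (poly_bijective k L U).2 t
  exact ⟨φ, congrFun hφ⟩

theorem under_comp_app {U V W : Under k} (φ : U ⟶ V) (ψ : V ⟶ W) {X : FinGSet G}
    (a : U.right.obj X) : (φ ≫ ψ).right.app X a = ψ.right.app X (φ.right.app X a) :=
  rfl

/-- The relations are expressions for the images of the variables under the two parallel maps.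
Cofork maps out of the coequalizer diagram then correspond to tuples that satisfy these relations.
-/
theorem FinitelyPresented.exists_isPresentation {f : k ⟶ R} (H : FinitelyPresented f) :
    ∃ (m n : ℕ) (L : Fin n → FinGSet G) (K : Fin m → FinGSet G) (x : ∀ i, R.obj (L i))
      (p q : ∀ j, Term (AlgGen k L) (K j)), IsPresentation f L K x p q := by
  obtain ⟨m, n, K, L, a, b, c, w, ⟨hc⟩⟩ := H
  choose p hp using fun j => polyMk_surjective (a.right.app _ (polyVar k K j))
  choose q hq using fun j => polyMk_surjective (b.right.app _ (polyVar k K j))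
  -- A morphism out of a polynomial algebra is determined on variables, so equalizing `a` and `b` is
  -- one equation for each `j`.
  have key {T : TambaraFunctor G} {h : k ⟶ T} (χ : poly k L ⟶ Under.mk h)
      {t : ∀ i, T.obj (L i)} (ht : ∀ i, χ.right.app _ (polyVar k L i) = t i) :
      a ≫ χ = b ≫ χ ↔ ∀ j, (p j).eval T (algVal h t) = (q j).eval T (algVal h t) := by
    have step (j : Fin m) : (p j).eval T (algVal h t) = (q j).eval T (algVal h t) ↔
        (a ≫ χ).right.app _ (polyVar k K j) = (b ≫ χ).right.app _ (polyVar k K j) := by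
      rw [under_comp_app, under_comp_app, ← hp, ← hq, map_polyMk _ χ ht, map_polyMk _ χ ht]
    exact ⟨fun h j => (step j).2 (by rw [h]), fun h => poly_hom_ext fun j => (step j).1 (h j)⟩
  refine ⟨m, n, L, K, fun i => c.right.app _ (polyVar k L i), p, q, (key c fun _ => rfl).1 w,
    fun T h t ht => ?_⟩
  obtain ⟨χ, hχ⟩ := poly_exists_hom (Under.mk h) t
  obtain ⟨d, hd, hu⟩ := Cofork.IsColimit.existsUnique hc χ ((key χ hχ).2 ht)
  refine ⟨d.right, ⟨Under.w d, fun i => ?_⟩, ?_⟩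
  · rw [← hχ i, ← hd]
    rfl
  · rintro φ ⟨h1, h2⟩
    refine congrArg (fun d : Under.mk f ⟶ Under.mk h => d.right)
      (hu (Under.homMk (U := Under.mk f) (V := Under.mk h) φ h1) ?_)
    exact poly_hom_ext fun i => (h2 i).trans (hχ i).symm

/-- Conversely, the parallel maps send the `j`-th variable to the two sides of the `j`-th relation,
and the universal properties coincide. -/
theorem IsPresentation.finitelyPresented {f : k ⟶ R} {m n : ℕ} {L : Fin n → FinGSet G}
    {K : Fin m → FinGSet G} {x : ∀ i, R.obj (L i)} {p q : ∀ j, Term (AlgGen k L) (K j)}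
    (H : IsPresentation f L K x p q) : FinitelyPresented f := by
  obtain ⟨a, ha⟩ := poly_exists_hom (poly k L) fun j => polyMk (p j)
  obtain ⟨b, hb⟩ := poly_exists_hom (poly k L) fun j => polyMk (q j)
  obtain ⟨c, hc⟩ := poly_exists_hom (Under.mk f) x
  have w : a ≫ c = b ≫ c := poly_hom_ext fun j => by
    rw [under_comp_app, under_comp_app, ha, hb, map_polyMk _ c hc, map_polyMk _ c hc]
    exact H.relation j
  refine ⟨m, n, K, L, a, b, c, w, ⟨Cofork.IsColimit.ofExistsUnique fun s => ?_⟩⟩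
  obtain ⟨φ, ⟨h1, h2⟩, hu⟩ := H.existsUnique s.pt.right s.pt.hom
    (fun i => s.π.right.app _ (polyVar k L i)) fun j => by
      have := congrArg (fun d : poly k K ⟶ s.pt => d.right.app _ (polyVar k K j)) s.condition
      rw [under_comp_app, under_comp_app, ha, hb] at this
      exact (map_polyMk (h := s.pt.hom) (p j) s.π (fun _ => rfl)).symm.trans
        (this.trans (map_polyMk (h := s.pt.hom) (q j) s.π (fun _ => rfl)))
  refine ⟨Under.homMk (U := Under.mk f) φ h1, ?_, ?_⟩
  · exact poly_hom_ext fun i => (congrArg (φ.app _) (hc i)).trans (h2 i)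
  · intro d hd
    apply Under.UnderMorphism.ext
    refine hu d.right ⟨Under.w d, fun i => ?_⟩
    rw [← hd, ← hc i]
    rfl

theorem FinitelyPresented.comp {f : k ⟶ R} {g : R ⟶ S} (hg : FinitelyPresented g)
    (hf : FinitelyPresented f) : FinitelyPresented (f ≫ g) := by
  obtain ⟨m, n, L, K, x, p, q, H⟩ := hf.exists_isPresentation
  obtain ⟨m', n', L', K', x', p', q', H'⟩ := hg.exists_isPresentation
  choose s hs using fun (X : FinGSet G) (r : R.obj X) => H.exists_eval_eq r
  -- The joined presentation is indexed by `Fin n ⊕ Fin n'` and `Fin m ⊕ Fin m'`; the reindexing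
  -- returns to the finite ordinals that `FinitelyPresented` requires.
  exact ((H.comp H' hs).reindex finSumFinEquiv.symm finSumFinEquiv.symm).finitelyPresented

end Presentation

end TambaraFunctor

theorem mainTheorem11 {G : Type u} [Group G] [Finite G] {k R S : TambaraFunctor G}
    (f : k ⟶ R) (g : R ⟶ S) :
    (TambaraFunctor.FinitelyPresented g → TambaraFunctor.FinitelyPresented f →
      TambaraFunctor.FinitelyPresented (f ≫ g)) ∧
    (TambaraFunctor.Flat g → TambaraFunctor.Flat f → TambaraFunctor.Flat (f ≫ g)) ∧
    ((TambaraFunctor.kaehler g).IsZero → (TambaraFunctor.kaehler f).IsZero →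
      (TambaraFunctor.kaehler (f ≫ g)).IsZero) ∧
    (TambaraFunctor.Etale f → TambaraFunctor.Etale g → TambaraFunctor.Etale (f ≫ g)) :=
  ⟨TambaraFunctor.FinitelyPresented.comp, TambaraFunctor.Flat.comp,
    TambaraFunctor.kaehler_comp_isZero f g, fun hf hg =>
    ⟨⟨TambaraFunctor.kaehler_comp_isZero f g hg.1.1 hf.1.1, hg.1.2.comp hf.1.2⟩, hg.2.comp hf.2⟩⟩
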